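/- Let $\Sigma_3=\{0,1,2\}$, and let $f,g\colon\Sigma_3^*\to\Sigma_3^*$ be the morphisms given by $f(0)=01$, $f(1)=022$, $f(2)=02$ and $g(0)=20$, $g(1)=21$, $g(2)=2$. Let $t_1,t_2\colon\Sigma_3^*\to\Sigma_3^*$ be the morphisms given by $$t_1(0)=001,\quad t_1(1)=00101101,\quad t_1(2)=0010110100101101,$$ $$t_2(0)=002,\quad t_2(1)=00202202,\quad t_2(2)=0020220200202202,$$ and for an infinite word $w=w_0w_1w_2w_3\cdots$ over $\Sigma_3$ let $\tau(w)=t_1(w_0)\,t_2(w_1)\,t_1(w_2)\,t_2(w_3)\cdots$. Let $f^\omega(0)$ be the infinite word that has $f^n(0)$ as a prefix for every $n\ge 0$, and let $\mathbf z=\tau(g(f^\omega(0)))$. A finite word $u=u_0\cdots u_{n-1}$ has period $p$, where $1\le p\le n$, if $u_{i+p}=u_i$ for all $0\le i<n-p$; in that case $n/p$ is an exponent of $u$. The critical exponent of an infinite word is the supremum of all $r\in\mathbb Q$ such that the word has a finite factor of exponent $r$. **Theorem.** The polynomial $x^3-2x^2-1$ has a unique real root $\mu_1\approx 2.20557$,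 and the critical exponent of $\mathbf z$ is $$1+\frac{1}{3-\mu_1}\approx 2.25876324.$$ -/

import Mathlib

namespace RichWord

/-- The alphabet `{0, 1, 2}`. Finite words over an alphabet `A` are lists `List A`, infinite words
are sequences `ℕ → A`. -/
abbrev Letter : Type := Fin 3

section General

variable {A : Type*}

/-- The prefix `w₀ w₁ ⋯ wₙ₋₁` of length `n` of an infinite word `w`. -/
def take (w : ℕ → A) (n : ℕ) : List A := (List.range n).map w

/-- The finite word `u` is a prefix of the infinite word `w`. -/
def IsPrefix (u : List A) (w : ℕ → A) : Prop := ∀ i : ℕ, ∀ h : i < u.length, u[i] = w i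

/-- The finite word `u` is a factor of the infinite word `w`, i.e. `u = wᵢ wᵢ₊₁ ⋯ wᵢ₊ₙ₋₁` for
some position `i`, where `n` is the length of `u`. -/
def IsFactor (u : List A) (w : ℕ → A) : Prop :=
  ∃ i : ℕ, ∀ j : ℕ, ∀ h : j < u.length, u[j] = w (i + j)

/-- `p` is a period of the finite word `u`: `1 ≤ p ≤ |u|` and `uᵢ₊ₚ = uᵢ` whenever both sides are
letters of `u`. -/
def IsPeriod (u : List A) (p : ℕ) : Prop :=
  1 ≤ p ∧ p ≤ u.length ∧ ∀ i : ℕ, ∀ h : i + p < u.length, u[i + p] = u[i]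

/-- `r` is an exponent of the finite word `u`: `r = |u| / p` for some period `p` of `u`. -/
def HasExponent (u : List A) (r : ℚ) : Prop :=
  ∃ p : ℕ, IsPeriod u p ∧ r = (u.length : ℚ) / (p : ℚ)

/-- The critical exponent of an infinite word: the supremum, in the extended reals, of all rational
`r` such that the word has a factor of exponent `r`. -/
noncomputable def criticalExponent (w : ℕ → A) : EReal :=
  sSup {a : EReal | ∃ r : ℚ, (∃ u : List A, IsFactor u w ∧ HasExponent u r) ∧ a = ((r : ℝ) : EReal)}

/-- The infinite word whose prefixes are the finite words `p n`. This is meaningful when each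
`p n` is a prefix of `p (n + 1)` and has length at least `n`, see `isPrefix_limitWord`. -/
def limitWord [Inhabited A] (p : ℕ → List A) : ℕ → A := fun i => (p (i + 1)).getD i default

theorem isPrefix_limitWord [Inhabited A] (p : ℕ → List A) (hp : ∀ n, p n <+: p (n + 1))
    (hl : ∀ n, n ≤ (p n).length) (n : ℕ) : IsPrefix (p n) (limitWord p) := by
  have mono : ∀ m k, p m <+: p (m + k) := by
    intro m k
    induction k with
    | zero => exact List.prefix_refl _
    | succ k ih => exact ih.trans (hp (m + k))
  intro i h
  have hi : i < (p (i + 1)).length := hl (i + 1)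
  have e : (p (i + 1)).getD i default = (p (i + 1))[i] := by simp [hi]
  change _ = (p (i + 1)).getD i default
  rw [e]
  rcases Nat.le_total n (i + 1) with hn | hn
  · obtain ⟨k, hk⟩ := Nat.exists_eq_add_of_le hn
    have := mono n k
    rw [← hk] at this
    exact this.getElem h
  · obtain ⟨k, hk⟩ := Nat.exists_eq_add_of_le hn
    have := mono (i + 1) k
    rw [← hk] at this
    exact (this.getElem hi).symm

theorem take_succ (w : ℕ → A) (n : ℕ) : take w (n + 1) = take w n ++ [w n] := by
  simp [take, List.range_succ]

end General

/-- The morphism on finite words determined by the images of the letters. -/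
def applyMorphism (h : Letter → List Letter) (u : List Letter) : List Letter := u.flatMap h

/-- The extension of a (non-erasing) morphism to infinite words:
`h(w₀ w₁ w₂ ⋯) = h(w₀) h(w₁) h(w₂) ⋯`. -/
def applyMorphismInf (h : Letter → List Letter) (w : ℕ → Letter) : ℕ → Letter :=
  limitWord fun n => applyMorphism h (take w n)

/-- For a morphism `h` that is prolongable on the letter `a`, the infinite word `h^ω(a)` that has
all `h^n(a)` as prefixes. -/
def fixedPoint (h : Letter → List Letter) (a : Letter) : ℕ → Letter :=
  limitWord fun n => (applyMorphism h)^[n] [a]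

/-- The morphism `0 ↦ 01`, `1 ↦ 022`, `2 ↦ 02`. -/
def f : Letter → List Letter
  | 0 => [0, 1]
  | 1 => [0, 2, 2]
  | 2 => [0, 2]

/-- The morphism `0 ↦ 20`, `1 ↦ 21`, `2 ↦ 2`. -/
def g : Letter → List Letter
  | 0 => [2, 0]
  | 1 => [2, 1]
  | 2 => [2]

/-- The output of the transducer in its first state. -/
def t₁ : Letter → List Letter
  | 0 => [0, 0, 1]
  | 1 => [0, 0, 1, 0, 1, 1, 0, 1]
  | 2 => [0, 0, 1, 0, 1, 1, 0, 1, 0, 0, 1, 0, 1, 1, 0, 1]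

/-- The output of the transducer in its second state. -/
def t₂ : Letter → List Letter
  | 0 => [0, 0, 2]
  | 1 => [0, 0, 2, 0, 2, 2, 0, 2]
  | 2 => [0, 0, 2, 0, 2, 2, 0, 2, 0, 0, 2, 0, 2, 2, 0, 2]

/-- The transducer `τ` on finite words: `t₁` is applied to the letters of even index and `t₂` to the
letters of odd index. -/
def tau (u : List Letter) : List Letter :=
  (u.mapIdx fun i a => if Even i then t₁ a else t₂ a).flatten

/-- The transducer `τ` on infinite words: `τ(w₀ w₁ w₂ ⋯) = t₁(w₀) t₂(w₁) t₁(w₂) t₂(w₃) ⋯`. -/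
def tauInf (w : ℕ → Letter) : ℕ → Letter := limitWord fun n => tau (take w n)

/-- The infinite word `x = f^ω(0)`. -/
def x : ℕ → Letter := fixedPoint f 0

/-- The infinite word `y = g(f^ω(0))`. -/
def y : ℕ → Letter := applyMorphismInf g x

/-- The infinite word `z = τ(g(f^ω(0)))`. -/
def z : ℕ → Letter := tauInf y

/-! The three infinite words are well defined: they have the expected finite prefixes. -/

theorem isPrefix_x (n : ℕ) : IsPrefix ((applyMorphism f)^[n] [0]) x := by
  refine isPrefix_limitWord (fun n => (applyMorphism f)^[n] [0])
    (fun n => ?_) (fun n => ?_) n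
  · induction n with
    | zero => exact ⟨[1], rfl⟩
    | succ n ih =>
      obtain ⟨s, hs⟩ := ih
      refine ⟨applyMorphism f s, ?_⟩
      have e : applyMorphism f ((applyMorphism f)^[n] [0] ++ s)
          = applyMorphism f ((applyMorphism f)^[n] [0]) ++ applyMorphism f s := by
        simp [applyMorphism]
      rw [hs, ← Function.iterate_succ_apply' (applyMorphism f),
        ← Function.iterate_succ_apply' (applyMorphism f)] at e
      exact e.symm
  · have key : ∀ u : List Letter, 2 * u.length ≤ (applyMorphism f u).length := by
      intro u
      induction u with
      | nil => simp
      | cons a u ih =>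
        have ha : 2 ≤ (f a).length := by fin_cases a <;> simp [f]
        simp only [applyMorphism, List.flatMap_cons, List.length_append, List.length_cons] at ih ⊢
        omega
    have : n + 1 ≤ ((applyMorphism f)^[n] [0]).length := by
      induction n with
      | zero => simp
      | succ n ih =>
        rw [Function.iterate_succ_apply']
        have := key ((applyMorphism f)^[n] [0])
        omega
    omega

theorem isPrefix_y (n : ℕ) : IsPrefix (applyMorphism g (take x n)) y := by
  refine isPrefix_limitWord (fun n => applyMorphism g (take x n))
    (fun n => ?_) (fun n => ?_) n
  · refine ⟨g (x n), ?_⟩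
    simp [take_succ, applyMorphism]
  · induction n with
    | zero => simp
    | succ n ih =>
      have ha : ∀ a, 1 ≤ (g a).length := by intro a; fin_cases a <;> simp [g]
      have := ha (x n)
      simp only [take_succ, applyMorphism, List.flatMap_append, List.length_append,
        List.flatMap_singleton] at ih ⊢
      omega

theorem tau_take_succ (w : ℕ → Letter) (n : ℕ) :
    tau (take w (n + 1)) = tau (take w n) ++ (if Even n then t₁ (w n) else t₂ (w n)) := by
  have : (take w n).length = n := by simp [take]
  simp [tau, take_succ, List.mapIdx_append, this]

theorem isPrefix_z (n : ℕ) : IsPrefix (tau (take y n)) z := by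
  refine isPrefix_limitWord (fun n => tau (take y n))
    (fun n => ?_) (fun n => ?_) n
  · exact ⟨_, (tau_take_succ y n).symm⟩
  · induction n with
    | zero => simp
    | succ n ih =>
      have ha : ∀ a, 1 ≤ (t₁ a).length ∧ 1 ≤ (t₂ a).length := by
        intro a; fin_cases a <;> simp [t₁, t₂]
      have := ha (y n)
      rw [tau_take_succ, List.length_append]
      split_ifs <;> omega

end RichWord

/-! A factor with period `p` and length `p + e` is a word `w[S..S+e)` repeated at distance `p`, so
the question is how large `e / p` can be. Write `x` for the fixed point of `f`. A maximal repetition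
(run) of `x` with a `0` in its window is the image under `f` of a shorter run, because `0` occurs
exactly at the start of each `f(a)`. The image is extended on both sides by an amount depending only
on whether the mismatching letters are `{1,2}` or involve `0`, and these two types alternate
(`Run.lift`). The same holds for passing from `x` to `z`, provided that both copies start in the
same transducer state (`Run.lift_z`).

Weighing letters by the lengths of their images under `τ ∘ g ∘ fⁿ` turns repeated lifting into a
change of `n`. `Run.bound` thus reduces all runs to those with no `0` in the window, which are few
(`Run.weights_of_ne_zero`). The extremal ones have an empty window and repeat one letter of weight
`wt n 0`. Their extension is asymptotic to `wt n 0 / (3 - μ)` (`ext_eq`, `abs_le_of_recurrence`),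
and an actual family in `z` attains the ratio in the limit (`exists_match_z_wt`).

A match of length at least 35 in `z` contains a synchronizing word and comes from a run of `x`
(`Match.exists_run_z`). Shorter ones that would beat the bound have period at most 27 and are
excluded by a finite check (`not_match_short`). -/

namespace RichWord

/-! ### Matches and maximal runs -/

section Runs

variable {A : Type*}

/-- The words `w[S..T)` and `w[S+p..T+p)` are equal. -/
def Match (w : ℕ → A) (S T p : ℕ) : Prop := ∀ j, S ≤ j → j < T → w j = w (j + p)

/-- A match that cannot be extended. -/
structure Run (w : ℕ → A) (s t p : ℕ) : Prop where
  le : s ≤ t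
  isMatch : Match w s t p
  left : ∀ j, j + 1 = s → w j ≠ w (j + p)
  right : w t ≠ w (t + p)

theorem Run.contains {w : ℕ → A} {s t p S T c : ℕ} (h : Run w s t p) (hm : Match w S T p)
    (hs : s ≤ c) (ht : c ≤ t) (hS : S ≤ c) (hT : c ≤ T) : s ≤ S ∧ T ≤ t := by
  constructor
  · by_contra! hlt
    obtain ⟨k, rfl⟩ := Nat.exists_eq_add_of_lt hlt
    exact h.left (S + k) rfl (hm _ (by omega) (by omega))
  · by_contra! hlt
    exact h.right (hm _ (by omega) hlt)

theorem Run.eq_of_mem {w : ℕ → A} {s t p s' t' c : ℕ} (h : Run w s t p) (h' : Run w s' t' p)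
    (hs : s ≤ c) (ht : c ≤ t) (hs' : s' ≤ c) (ht' : c ≤ t') : s = s' ∧ t = t' := by
  have h1 := h.contains h'.isMatch hs ht hs' ht'
  have h2 := h'.contains h.isMatch hs' ht' hs ht
  omega

theorem Match.append {w : ℕ → A} {a b c p : ℕ} (h1 : Match w a b p)
    (h2 : Match w b c p) : Match w a c p := fun j hj1 hj2 => by
  by_cases h : j < b
  · exact h1 j hj1 h
  · exact h2 j (by omega) hj2

end Runs

/-! ### Weighted positions -/

/-- The total weight of the first `m` letters of `w`. -/
def pos (w : ℕ → Letter) (v : Letter → ℕ) (m : ℕ) : ℕ := ∑ j ∈ Finset.range m, v (w j)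

@[simp] theorem pos_zero (w : ℕ → Letter) (v : Letter → ℕ) : pos w v 0 = 0 := rfl

theorem pos_succ (w : ℕ → Letter) (v : Letter → ℕ) (m : ℕ) :
    pos w v (m + 1) = pos w v m + v (w m) := Finset.sum_range_succ _ _

theorem pos_mono (w : ℕ → Letter) (v : Letter → ℕ) : Monotone (pos w v) :=
  monotone_nat_of_le_succ fun m => by rw [pos_succ]; omega

theorem add_mul_le_pos_add (w : ℕ → Letter) (v : Letter → ℕ) (c : ℕ) (hv : ∀ a, c ≤ v a)
    (m k : ℕ) : pos w v m + c * k ≤ pos w v (m + k) := by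
  induction k with
  | zero => simp
  | succ k ih =>
    have := hv (w (m + k))
    rw [← add_assoc, pos_succ, mul_add]
    omega

/-- Matched letters have equal weights, so the weighted distance between the two copies is constant
along a match. -/
theorem Match.pos_add {w : ℕ → Letter} {s t q m : ℕ} (h : Match w s t q) (v : Letter → ℕ)
    (hs : s ≤ m) (ht : m ≤ t) : pos w v (m + q) + pos w v s = pos w v m + pos w v (s + q) := by
  induction m, hs using Nat.le_induction with
  | base => ring
  | succ m hm ih =>
    rw [show m + 1 + q = m + q + 1 by ring, pos_succ, pos_succ, ← h m hm (by omega)]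
    linarith [ih (by omega)]

/-- Every position lies in the image of a unique letter. -/
theorem exists_pos_add (w : ℕ → Letter) (v : Letter → ℕ) (hv : ∀ a, 1 ≤ v a) (n : ℕ) :
    ∃ m k, n = pos w v m + k ∧ k < v (w m) := by
  induction n with
  | zero => exact ⟨0, 0, rfl, hv _⟩
  | succ n ih =>
    obtain ⟨m, k, h1, h2⟩ := ih
    by_cases h : k + 1 < v (w m)
    · exact ⟨m, k + 1, by omega, h⟩
    · exact ⟨m + 1, 0, by rw [pos_succ]; omega, hv _⟩

/-! ### Block decompositions of `x`, `y` and `z` -/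

theorem IsPrefix.append_right {w : ℕ → Letter} {a b : List Letter} (h : IsPrefix (a ++ b) w)
    {k : ℕ} (hk : k < b.length) : w (a.length + k) = b.getD k 0 := by
  have := h (a.length + k) (by simp; omega)
  rw [← this, List.getElem_append_right (by omega)]
  simp [hk]

theorem IsPrefix.append_left {w : ℕ → Letter} {a b : List Letter} (h : IsPrefix (a ++ b) w) :
    IsPrefix a w := by
  intro i hi
  have := h i (by simp; omega)
  rwa [List.getElem_append_left hi] at this

theorem IsPrefix.eq_take_append {w : ℕ → Letter} {u : List Letter} (h : IsPrefix u w) {n : ℕ}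
    (hn : n ≤ u.length) : u = take w n ++ u.drop n := by
  have : u.take n = take w n := by
    apply List.ext_getElem
    · simp [take, hn]
    · intro i h1 h2
      have hi : i < u.length := by simp at h1; omega
      simp [take, h i hi]
  rw [← this, List.take_append_drop]

theorem length_applyMorphism_take (h : Letter → List Letter) (w : ℕ → Letter) (m : ℕ) :
    (applyMorphism h (take w m)).length = pos w (fun a => (h a).length) m := by
  induction m with
  | zero => simp [take, applyMorphism]
  | succ m ih =>
    rw [take_succ, pos_succ, ← ih]
    simp [applyMorphism]

theorem length_iterate_f (n : ℕ) : n ≤ ((applyMorphism f)^[n] [0]).length := by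
  have key : ∀ u : List Letter, 2 * u.length ≤ (applyMorphism f u).length := by
    intro u
    induction u with
    | nil => simp
    | cons a u ih =>
      have ha : 2 ≤ (f a).length := by fin_cases a <;> simp [f]
      simp only [applyMorphism, List.flatMap_cons, List.length_append, List.length_cons] at ih ⊢
      omega
  have : n + 1 ≤ ((applyMorphism f)^[n] [0]).length := by
    induction n with
    | zero => simp
    | succ n ih =>
      rw [Function.iterate_succ_apply']
      have := key ((applyMorphism f)^[n] [0])
      omega
  omega

/-- The position of the image of the `m`-th letter in `x = f(x)`. -/
abbrev F (m : ℕ) : ℕ := pos x (fun a => (f a).length) m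

theorem x_F_add (m k : ℕ) (hk : k < (f (x m)).length) : x (F m + k) = (f (x m)).getD k 0 := by
  have h := isPrefix_x (m + 1 + 1)
  rw [Function.iterate_succ_apply',
    (isPrefix_x (m + 1)).eq_take_append (length_iterate_f (m + 1)), take_succ] at h
  simp only [applyMorphism, List.flatMap_append, List.flatMap_singleton] at h
  have := h.append_left.append_right hk
  rwa [← applyMorphism, length_applyMorphism_take] at this

theorem y_pos_add (m k : ℕ) (hk : k < (g (x m)).length) :
    y (pos x (fun a => (g a).length) m + k) = (g (x m)).getD k 0 := by
  have h := isPrefix_y (m + 1)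
  rw [take_succ] at h
  simp only [applyMorphism, List.flatMap_append, List.flatMap_singleton] at h
  have := h.append_right hk
  rwa [← applyMorphism, length_applyMorphism_take] at this

/-- The output block of the transducer, in its first state if `e` holds. -/
def T (e : Bool) (a : Letter) : List Letter := if e then t₁ a else t₂ a

theorem length_T (e : Bool) (a : Letter) : (T e a).length = (t₁ a).length := by
  revert e a; decide

theorem length_tau_take (w : ℕ → Letter) (m : ℕ) :
    (tau (take w m)).length = pos w (fun a => (t₁ a).length) m := by
  induction m with
  | zero => simp [take, tau]
  | succ m ih =>
    have h : (t₂ (w m)).length = (t₁ (w m)).length := length_T false _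
    rw [tau_take_succ, pos_succ, ← ih, List.length_append]
    split_ifs <;> simp [h]

theorem z_pos_add (m k : ℕ) (hk : k < (t₁ (y m)).length) :
    z (pos y (fun a => (t₁ a).length) m + k) = (T (decide (Even m)) (y m)).getD k 0 := by
  have h := isPrefix_z (m + 1)
  rw [tau_take_succ] at h
  have e : (if Even m then t₁ (y m) else t₂ (y m)) = T (decide (Even m)) (y m) := by simp [T]
  rw [e] at h
  have := h.append_right (k := k) (by rwa [length_T])
  rwa [length_tau_take] at this

/-- The parity of the position following the image of `a` under `g`. -/
def flip (e : Bool) (a : Letter) : Bool := if a = 2 then !e else e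

/-- The image of the letter `a` of `x` in `z`, if that of `a` in `y` starts at a position of
parity `e`. -/
def block (e : Bool) (a : Letter) : List Letter :=
  match a with
  | 0 => T e 2 ++ T (!e) 0
  | 1 => T e 2 ++ T (!e) 1
  | 2 => T e 2

/-- Whether the image of the `m`-th letter of `x` starts at an even position of `y`. -/
def par : ℕ → Bool
  | 0 => true
  | m + 1 => flip (par m) (x m)

/-- The weights of the letters: the lengths of their images under `τ ∘ g ∘ fⁿ`. -/
def wt : ℕ → Letter → ℕ
  | 0 => ![19, 24, 16]
  | n + 1 => ![wt n 0 + wt n 1, wt n 0 + 2 * wt n 2, wt n 0 + wt n 2]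

theorem length_block (e : Bool) (a : Letter) : (block e a).length = wt 0 a := by
  revert e a; decide

/-- The position in `z` of the image of the `m`-th letter of `x`. -/
abbrev Z (m : ℕ) : ℕ := pos x (wt 0) m

theorem par_eq (m : ℕ) : par m = decide (Even (pos x (fun a => (g a).length) m)) := by
  induction m with
  | zero => simp [par]
  | succ m ih =>
    rw [par, ih, pos_succ]
    generalize pos x (fun a => (g a).length) m = n
    generalize x m = a
    fin_cases a <;> by_cases hn : Even n <;> simp [flip, g, parity_simps, hn]

theorem g_getD_zero (a : Letter) : (g a).getD 0 0 = 2 := by revert a; decide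

theorem g_getD_one (a : Letter) (h : 1 < (g a).length) : (g a).getD 1 0 = a := by
  revert a; decide

theorem length_g_pos (a : Letter) : 0 < (g a).length := by revert a; decide

theorem pos_y_pos (m : ℕ) :
    pos y (fun a => (t₁ a).length) (pos x (fun a => (g a).length) m) = Z m := by
  induction m with
  | zero => rfl
  | succ m ih =>
    have h0 := y_pos_add m 0 (length_g_pos _)
    have h1 := y_pos_add m 1
    rw [g_getD_zero, add_zero] at h0
    rw [pos_succ x, Z, pos_succ, ← Z, ← ih]
    generalize pos x (fun a => (g a).length) m = n at *
    generalize x m = a at *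
    have e2 : ((t₁ (2 : Letter)).length) = 16 := rfl
    match a with
    | 0 =>
      have h1' : y (n + 1) = 0 := h1 (by decide)
      exact (pos_succ _ _ (n + 1)).trans (by rw [pos_succ, h0, h1']; rfl)
    | 1 =>
      have h1' : y (n + 1) = 1 := h1 (by decide)
      exact (pos_succ _ _ (n + 1)).trans (by rw [pos_succ, h0, h1']; rfl)
    | 2 => exact (pos_succ _ _ n).trans (by rw [h0]; rfl)

theorem block_getD_left : ∀ (e : Bool) (a : Letter), ∀ k < 16,
    (T e 2).getD k 0 = (block e a).getD k 0 := by
  decide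

theorem block_getD_right : ∀ (e : Bool) (a : Letter), a ≠ 2 → ∀ k < (t₁ a).length,
    (T (!e) a).getD k 0 = (block e a).getD (16 + k) 0 := by
  decide

theorem z_Z_add (m k : ℕ) (hk : k < wt 0 (x m)) :
    z (Z m + k) = (block (par m) (x m)).getD k 0 := by
  have hy0 := y_pos_add m 0 (length_g_pos _)
  have hy1 := y_pos_add m 1
  have h0 := z_pos_add (pos x (fun a => (g a).length) m)
  have h1 := z_pos_add (pos x (fun a => (g a).length) m + 1)
  have hp := par_eq m
  rw [pos_succ, pos_y_pos] at h1
  rw [pos_y_pos, ← hp] at h0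
  rw [g_getD_zero, add_zero] at hy0
  have hp' : decide (Even (pos x (fun a => (g a).length) m + 1)) = !par m := by
    rw [hp]
    generalize pos x (fun a => (g a).length) m = n
    by_cases hn : Even n <;> simp [parity_simps, hn]
  rw [hp', hy0, show (t₁ 2).length = 16 from rfl] at h1
  rw [hy0, show (t₁ 2).length = 16 from rfl] at h0
  by_cases hk16 : k < 16
  · rw [h0 k hk16]
    exact block_getD_left _ _ k hk16
  · obtain ⟨i, rfl⟩ := Nat.exists_eq_add_of_le (not_lt.1 hk16)
    have ha : x m ≠ 2 ∧ 1 < (g (x m)).length ∧ wt 0 (x m) = 16 + (t₁ (x m)).length := by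
      generalize x m = a at *
      match a with
      | 0 => decide
      | 1 => decide
      | 2 => simp [wt] at hk
    rw [hy1 ha.2.1, g_getD_one _ ha.2.1] at h1
    rw [← add_assoc, h1 i (by omega)]
    exact block_getD_right _ _ ha.1 i (by omega)

/-! ### Desubstitution and aperiodicity of `x` -/

theorem two_le_length_f : ∀ a : Letter, 2 ≤ (f a).length := by decide

theorem F_add_two_mul_le (m k : ℕ) : F m + 2 * k ≤ F (m + k) :=
  add_mul_le_pos_add _ _ 2 two_le_length_f m k

theorem two_mul_le_F (m : ℕ) : 2 * m ≤ F m := by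
  simpa using F_add_two_mul_le 0 m

theorem x_F (m : ℕ) : x (F m) = 0 := by
  have h : ∀ a : Letter, 0 < (f a).length ∧ (f a).getD 0 0 = 0 := by decide
  have := x_F_add m 0 (h _).1
  rwa [(h _).2] at this

/-- The first three letters that follow the start of the image of a letter. -/
theorem x_F_add_lt_three (m k : ℕ) (hk : k < 3) : x (F m + k) = (f (x m) ++ [0]).getD k 0 := by
  have h : ∀ a : Letter, ∀ k < 3, (k < (f a).length ∧ (f a ++ [0]).getD k 0 = (f a).getD k 0) ∨
      (k = (f a).length ∧ (f a ++ [0]).getD k 0 = 0) := by decide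
  rcases h (x m) k hk with ⟨h1, h2⟩ | ⟨h1, h2⟩
  · rw [h2, x_F_add m k h1]
  · rw [h2, h1, ← pos_succ x (fun a => (f a).length) m, x_F]

/-- The last two letters of the image of a letter. -/
theorem x_F_succ_sub (m : ℕ) : ∃ N, F (m + 1) = N + 2 ∧
    x N = (f (x m)).reverse.getD 1 0 ∧ x (N + 1) = (f (x m)).reverse.getD 0 0 := by
  have h2 := two_le_length_f (x m)
  have h : ∀ a : Letter, (f a).getD ((f a).length - 2) 0 = (f a).reverse.getD 1 0 ∧
    (f a).getD ((f a).length - 2 + 1) 0 = (f a).reverse.getD 0 0 := by decide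
  refine ⟨F m + ((f (x m)).length - 2), ?_, ?_, ?_⟩
  · rw [F, F, pos_succ]; omega
  · rw [x_F_add _ _ (by omega), (h _).1]
  · rw [add_assoc, x_F_add _ _ (by omega), (h _).2]

/-- Each `f(a)` has its only `0` in first place, so zeros mark the cutting points of `x = f(x)`. -/
theorem exists_F_eq {j : ℕ} (hj : x j = 0) : ∃ a, j = F a := by
  obtain ⟨m, k, rfl, hk⟩ := exists_pos_add x (fun a => (f a).length)
    (fun a => (by decide : 1 ≤ 2).trans (two_le_length_f a)) j
  have h : ∀ a : Letter, ∀ k < (f a).length, (f a).getD k 0 = 0 → k = 0 := by decide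
  rw [x_F_add m k hk] at hj
  exact ⟨m, by rw [h _ _ hk hj]; rfl⟩

/-- `x` is not eventually periodic. -/
theorem exists_ne_add (q : ℕ) (hq : 1 ≤ q) (s : ℕ) : ∃ t, s ≤ t ∧ x t ≠ x (t + q) := by
  induction q using Nat.strong_induction_on generalizing s with
  | _ q ih =>
  by_contra! hcon
  have hs : s ≤ F s := by have := two_mul_le_F s; omega
  -- Descent: an eventual period `q` carries cutting points to cutting points. The index difference
  -- `q' + 1` is again an eventual period, and it is smaller than `q` because images have length at
  -- least 2.
  obtain ⟨m, hm⟩ := exists_F_eq (j := F s + q) (by rw [← hcon _ hs, x_F])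
  have hsm : s < m := by
    by_contra! h
    have := pos_mono x (fun a => (f a).length) h
    change F m ≤ F s at this
    omega
  obtain ⟨q', rfl⟩ := Nat.exists_eq_add_of_lt hsm
  have hlt := F_add_two_mul_le s (q' + 1)
  rw [← add_assoc] at hlt
  have key : ∀ k, F (s + k + (q' + 1)) = F (s + k) + q ∧ x (s + k) = x (s + k + (q' + 1)) := by
    have letter : ∀ k, F (k + (q' + 1)) = F k + q → s ≤ k → x k = x (k + (q' + 1)) := by
      intro k hF hk
      have hkF : s ≤ F k := by have := two_mul_le_F k; omega
      have h0 : ∀ i < 3, (f (x k) ++ [0]).getD i 0 = (f (x (k + (q' + 1))) ++ [0]).getD i 0 := by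
        intro i hi
        rw [← x_F_add_lt_three k i hi, ← x_F_add_lt_three _ i hi, hF, hcon _ (by omega)]
        congr 1
        omega
      -- The words `010`, `022`, `020` that begin `f(a)0` are distinct.
      have inj : ∀ a b : Letter,
          (∀ i < 3, (f a ++ [0]).getD i 0 = (f b ++ [0]).getD i 0) → a = b := by decide
      exact inj _ _ h0
    intro k
    induction k with
    | zero =>
      have h : F (s + (q' + 1)) = F s + q := by rw [← add_assoc, ← hm]
      exact ⟨h, letter s h le_rfl⟩
    | succ k ihk =>
      have h : F (s + (k + 1) + (q' + 1)) = F (s + (k + 1)) + q := by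
        have e : s + (k + 1) + (q' + 1) = s + k + (q' + 1) + 1 := by ring
        rw [e, ← add_assoc s k 1, F, F, pos_succ, pos_succ, ← F, ← F, ihk.1, ← ihk.2]
        ring
      exact ⟨h, letter _ h (by omega)⟩
  obtain ⟨t, ht, hne⟩ := ih (q' + 1) (by omega) (by omega) s
  obtain ⟨k, rfl⟩ := Nat.exists_eq_add_of_le ht
  exact hne (key k).2

theorem exists_run (a q : ℕ) (hq : 1 ≤ q) : ∃ s t, s ≤ a ∧ a ≤ t ∧ Run x s t q := by
  classical
  have hs : ∃ s, s ≤ a ∧ Match x s a q := ⟨a, le_rfl, fun j h1 h2 => absurd h2 (by omega)⟩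
  have ht := exists_ne_add q hq a
  obtain ⟨hs1, hs2⟩ := Nat.find_spec hs
  obtain ⟨ht1, ht2⟩ := Nat.find_spec ht
  refine ⟨Nat.find hs, Nat.find ht, hs1, ht1, by omega, ?_, ?_, ht2⟩
  · intro j h1 h2
    by_cases hj : j < a
    · exact hs2 j h1 hj
    · have := Nat.find_min ht h2
      push Not at this
      exact this (by omega)
  · intro j hj h
    refine Nat.find_min hs (m := j) (by omega) ⟨by omega, fun i h1 h2 => ?_⟩
    rcases h1.eq_or_lt with rfl | h1
    · exact h
    · exact hs2 i (by omega) h2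

/-! ### Lifting runs through `f` -/

/-- The left mismatch of a run consists of the letters `1` and `2` (`b = true`), or contains the
letter `0` or is absent (`b = false`). -/
def LType (s p : ℕ) (b : Bool) : Prop :=
  (s = 0 ∧ b = false) ∨ ∃ j, s = j + 1 ∧ b = decide (x j ≠ 0 ∧ x (j + p) ≠ 0)

/-- The right mismatch of a run consists of the letters `1` and `2` (`b = true`), or contains the
letter `0` (`b = false`). -/
def RType (t p : ℕ) (b : Bool) : Prop := b = decide (x t ≠ 0 ∧ x (t + p) ≠ 0)

theorem exists_LType (s p : ℕ) : ∃ b, LType s p b := by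
  rcases s with _ | j
  · exact ⟨_, .inl ⟨rfl, rfl⟩⟩
  · exact ⟨_, .inr ⟨j, rfl, rfl⟩⟩

/-- Compare `f(c)0` with `f(d)0`: for `{1,2}` the common prefix is `02`, followed by `2` against
`0`; if one letter is `0` it is `0`, followed by `1` against `2`. Hence the type flips. -/
theorem lift_right {t p q : ℕ} {b : Bool} (h : x t ≠ x (t + q)) (hF : F (t + q) = F t + p)
    (hb : RType t q b) :
    Match x (F t) (F t + 1 + b.toNat) p ∧
    x (F t + 1 + b.toNat) ≠ x (F t + 1 + b.toNat + p) ∧ RType (F t + 1 + b.toNat) p (!b) := by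
  have key : ∀ c d : Letter, c ≠ d → ∀ b, b = decide (c ≠ 0 ∧ d ≠ 0) →
      (∀ k < 1 + b.toNat, (f c ++ [0]).getD k 0 = (f d ++ [0]).getD k 0) ∧
      (f c ++ [0]).getD (1 + b.toNat) 0 ≠ (f d ++ [0]).getD (1 + b.toNat) 0 ∧
      (!b) = decide ((f c ++ [0]).getD (1 + b.toNat) 0 ≠ 0 ∧
        (f d ++ [0]).getD (1 + b.toNat) 0 ≠ 0) := by decide
  obtain ⟨h1, h2, h3⟩ := key _ _ h b hb
  have hb1 : b.toNat ≤ 1 := Bool.toNat_le b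
  have e2 : ∀ k < 3, x (F t + k + p) = (f (x (t + q)) ++ [0]).getD k 0 := by
    intro k hk
    rw [← x_F_add_lt_three _ k hk, hF]
    congr 1
    omega
  refine ⟨fun j hj1 hj2 => ?_, ?_, ?_⟩
  · obtain ⟨k, rfl⟩ := Nat.exists_eq_add_of_le hj1
    rw [x_F_add_lt_three _ _ (by omega), e2 _ (by omega)]
    exact h1 k (by omega)
  · rw [add_assoc (F t), x_F_add_lt_three _ _ (by omega), e2 _ (by omega)]
    exact h2
  · rw [RType, add_assoc (F t), x_F_add_lt_three _ _ (by omega), e2 _ (by omega)]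
    exact h3

/-- The images of `1` and `2` share the last letter `2`, preceded by `2` and `0`. The image of `0`
ends in `1`, so there the mismatch is immediate and of type `{1,2}`. -/
theorem lift_left {j p q : ℕ} {b : Bool} (h : x j ≠ x (j + q))
    (hF : F (j + 1 + q) = F (j + 1) + p) (hb : b = decide (x j ≠ 0 ∧ x (j + q) ≠ 0)) :
    ∃ N, F (j + 1) = N + 1 + b.toNat ∧ Match x (N + 1) (F (j + 1)) p ∧ x N ≠ x (N + p) ∧
      (!b) = decide (x N ≠ 0 ∧ x (N + p) ≠ 0) := by
  have key : ∀ c d : Letter, c ≠ d → ∀ b, b = decide (c ≠ 0 ∧ d ≠ 0) →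
      (b = true → (f c).reverse.getD 0 0 = (f d).reverse.getD 0 0) ∧
      (f c).reverse.getD b.toNat 0 ≠ (f d).reverse.getD b.toNat 0 ∧
      (!b) = decide ((f c).reverse.getD b.toNat 0 ≠ 0 ∧
        (f d).reverse.getD b.toNat 0 ≠ 0) := by decide
  obtain ⟨h1, h2, h3⟩ := key _ _ h b hb
  obtain ⟨N, hN, hN0, hN1⟩ := x_F_succ_sub j
  obtain ⟨N', hN', hN0', hN1'⟩ := x_F_succ_sub (j + q)
  have hNN : N' = N + p := by
    have e : j + q + 1 = j + 1 + q := by ring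
    rw [e] at hN'
    omega
  subst hNN
  have e1 : N + p + 1 = N + 1 + p := by ring
  rw [e1] at hN1'
  cases b with
  | false =>
    refine ⟨N + 1, hN, fun i h1 h2 => absurd h2 (by omega), ?_, ?_⟩
    · rw [hN1, hN1']; exact h2
    · rw [hN1, hN1']; exact h3
  | true =>
    refine ⟨N, hN, fun i hi1 hi2 => ?_, ?_, ?_⟩
    · have : i = N + 1 := by omega
      rw [this, hN1, hN1']
      exact h1 rfl
    · rw [hN0, hN0']; exact h2
    · rw [hN0, hN0']; exact h3

theorem Run.F_add {s t p q m m' : ℕ} (h : Run x s t q) (hF : F (m + q) = F m + p) (hs : s ≤ m)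
    (hm : m ≤ t) (hs' : s ≤ m') (hm' : m' ≤ t) : F (m' + q) = F m' + p := by
  have h1 := h.isMatch.pos_add (fun a => (f a).length) hs hm
  have h2 := h.isMatch.pos_add (fun a => (f a).length) hs' hm'
  simp only [F] at *
  omega

theorem Run.match_F {s t p q : ℕ} (h : Run x s t q) (hF : F (s + q) = F s + p) :
    Match x (F s) (F t) p := by
  intro j h1 h2
  obtain ⟨m, k, rfl, hk⟩ := exists_pos_add x (fun a => (f a).length)
    (fun a => (by decide : 1 ≤ 2).trans (two_le_length_f a)) j
  rw [← F] at h1 h2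
  have hms : s ≤ m := by
    by_contra! hlt
    have := pos_mono x (fun a => (f a).length) (Nat.succ_le_of_lt hlt)
    rw [Nat.succ_eq_add_one, pos_succ, ← F, ← F] at this
    omega
  have hmt : m < t := by
    by_contra! hle
    have := pos_mono x (fun a => (f a).length) hle
    rw [← F, ← F] at this
    omega
  have e : F m + k + p = F (m + q) + k := by rw [h.F_add hF le_rfl h.le hms hmt.le]; ring
  change x (F m + k) = x (F m + k + p)
  rw [e, x_F_add m k hk, x_F_add (m + q) k (by rwa [← h.isMatch m hms hmt]),
    h.isMatch m hms hmt]

/-- The image of a run of `x` under `f`. -/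
theorem Run.lift {s t p q : ℕ} {bl br : Bool} (h : Run x s t q) (hF : F (s + q) = F s + p)
    (hl : LType s q bl) (hr : RType t q br) :
    ∃ s', Run x s' (F t + 1 + br.toNat) p ∧ RType (F t + 1 + br.toNat) p (!br) ∧ s' ≤ F s ∧
      ((s = 0 ∧ s' = 0 ∧ bl = false) ∨ (F s = s' + bl.toNat ∧ LType s' p (!bl))) := by
  obtain ⟨r1, r2, r3⟩ := lift_right h.right (h.F_add hF le_rfl h.le h.le le_rfl) hr
  have hFst : F s ≤ F t := pos_mono _ _ h.le
  rcases hl with ⟨rfl, rfl⟩ | ⟨j, rfl, hb⟩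
  · exact ⟨0, ⟨by omega, (h.match_F hF).append r1, fun j hj => absurd hj (by omega), r2⟩, r3,
      by omega, .inl ⟨rfl, rfl, rfl⟩⟩
  · obtain ⟨N, hN, l1, l2, l3⟩ := lift_left (h.left j rfl) hF hb
    refine ⟨N + 1, ⟨by omega, l1.append ((h.match_F hF).append r1), ?_, r2⟩, r3, by omega,
      .inr ⟨hN, .inr ⟨N, rfl, l3⟩⟩⟩
    rintro i hi
    obtain rfl : i = N := by omega
    exact l2

theorem x_zero : x 0 = 0 := x_F 0

theorem F_succ (m : ℕ) : F (m + 1) = F m + (f (x m)).length := pos_succ _ _ _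

/-- As `x = f(x)`, applying `f` trades one level of weights for a longer prefix. -/
theorem pos_wt_succ (n m : ℕ) : pos x (wt (n + 1)) m = pos x (wt n) (F m) := by
  induction m with
  | zero => rfl
  | succ m ih =>
    have h := x_F_add m
    rw [pos_succ, ih, F_succ]
    generalize F m = N at *
    generalize x m = a at *
    match a with
    | 0 =>
      have h0 : x N = 0 := h 0 (by decide)
      have h1 : x (N + 1) = 1 := h 1 (by decide)
      change _ = pos x (wt n) (N + 1 + 1)
      rw [pos_succ, pos_succ, h0, h1, add_assoc]
      rfl
    | 1 =>
      have h0 : x N = 0 := h 0 (by decide)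
      have h1 : x (N + 1) = 2 := h 1 (by decide)
      have h2 : x (N + 2) = 2 := h 2 (by decide)
      change _ = pos x (wt n) (N + 2 + 1)
      rw [pos_succ, pos_succ, pos_succ, h0, h1, h2]
      change _ + (wt n 0 + 2 * wt n 2) = _
      ring
    | 2 =>
      have h0 : x N = 0 := h 0 (by decide)
      have h1 : x (N + 1) = 2 := h 1 (by decide)
      change _ = pos x (wt n) (N + 1 + 1)
      rw [pos_succ, pos_succ, h0, h1, add_assoc]
      rfl

/-- Only the letter `2` changes the parity, and `f(0)`, `f(1)`, `f(2)` contain 0, 2 and 1 letters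
`2`. -/
theorem par_F (m : ℕ) : par (F m) = par m := by
  induction m with
  | zero => rfl
  | succ m ih =>
    have h := x_F_add m
    rw [F_succ, par, ← ih]
    generalize F m = N at *
    generalize x m = a at *
    match a with
    | 0 =>
      have h0 : x N = 0 := h 0 (by decide)
      have h1 : x (N + 1) = 1 := h 1 (by decide)
      change par (N + 1 + 1) = _
      rw [par, par, h0, h1]
      rfl
    | 1 =>
      have h0 : x N = 0 := h 0 (by decide)
      have h1 : x (N + 1) = 2 := h 1 (by decide)
      have h2 : x (N + 2) = 2 := h 2 (by decide)
      change par (N + 2 + 1) = _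
      rw [par, par, par, h0, h1, h2]
      cases par N <;> rfl
    | 2 =>
      have h0 : x N = 0 := h 0 (by decide)
      have h1 : x (N + 1) = 2 := h 1 (by decide)
      change par (N + 1 + 1) = _
      rw [par, par, h0, h1]
      rfl

theorem flip_injective (a : Letter) : ∀ e e', flip e a = flip e' a ↔ e = e' := by
  revert a; decide

theorem Match.par_add {s t q m : ℕ} (h : Match x s t q) (hs : s ≤ m) (ht : m ≤ t) :
    par (m + q) = par m ↔ par (s + q) = par s := by
  induction m, hs using Nat.le_induction with
  | base => rfl
  | succ m hm ih =>
    rw [show m + 1 + q = m + q + 1 by ring, par, par, ← h m hm (by omega), flip_injective,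
      ih (by omega)]

/-! ### Weights and extensions at level `n` -/

/-- The length of the extension of a run to the left in `τ(g(fⁿ(x)))`. -/
def extL : ℕ → Bool → ℕ
  | 0, b => if b then 8 else 2
  | n + 1, b => if b then wt n 2 + extL n false else extL n true

/-- The length of the extension of a run to the right in `τ(g(fⁿ(x)))`. -/
def extR : ℕ → Bool → ℕ
  | 0, b => if b then 26 else 20
  | n + 1, b => if b then wt n 0 + wt n 2 + extR n false else wt n 0 + extR n true

/-- The conjunction is chosen to be inductive. The fourth and fifth parts yield the ratio `5/4` for
the non-critical runs; the last gives unbounded growth. -/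
theorem wt_bounds (n : ℕ) : wt n 2 ≤ wt n 0 ∧ wt n 0 ≤ wt n 1 ∧ wt n 1 ≤ 2 * wt n 2 ∧
    wt n 1 ≤ wt n 0 + wt n 2 ∧ wt n 0 + 3 * wt n 1 ≤ 7 * wt n 2 ∧ 16 + n ≤ wt n 2 := by
  induction n with
  | zero => decide
  | succ n ih =>
    have e0 : wt (n + 1) 0 = wt n 0 + wt n 1 := rfl
    have e1 : wt (n + 1) 1 = wt n 0 + 2 * wt n 2 := rfl
    have e2 : wt (n + 1) 2 = wt n 0 + wt n 2 := rfl
    omega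

theorem wt_two_le (n : ℕ) (a : Letter) : wt n 2 ≤ wt n a := by
  have := wt_bounds n
  match a with
  | 0 => omega
  | 1 => omega
  | 2 => exact le_rfl

theorem extL_le (n : ℕ) : extL n false ≤ extL n true ∧ extL n true ≤ extL n false + wt n 2 := by
  induction n with
  | zero => decide
  | succ n ih =>
    have := wt_bounds n
    have e2 : wt (n + 1) 2 = wt n 0 + wt n 2 := rfl
    simp only [extL, e2]
    simp only [Bool.false_eq_true, if_true, if_false]
    omega

theorem extR_le (n : ℕ) : extR n false ≤ extR n true ∧ extR n true ≤ extR n false + wt n 2 := by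
  induction n with
  | zero => decide
  | succ n ih =>
    have := wt_bounds n
    have e2 : wt (n + 1) 2 = wt n 0 + wt n 2 := rfl
    simp only [extR, e2]
    simp only [Bool.false_eq_true, if_true, if_false]
    omega

theorem extL_le_true (n : ℕ) (b : Bool) : extL n b ≤ extL n true := by
  have := extL_le n
  cases b <;> omega

theorem extR_le_true (n : ℕ) (b : Bool) : extR n b ≤ extR n true := by
  have := extR_le n
  cases b <;> omega

/-- The weights on both sides of `Run.lift` agree. -/
theorem Run.lift_wt {s t p q : ℕ} {bl br : Bool} (h : Run x s t q) (hF : F (s + q) = F s + p)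
    (hl : LType s q bl) (hr : RType t q br) :
    ∃ s' t' bl', Run x s' t' p ∧ LType s' p bl' ∧ RType t' p (!br) ∧ s' ≤ F s ∧ F t < t' ∧
      (∀ n, pos x (wt (n + 1)) (s + q) + pos x (wt n) s' =
        pos x (wt (n + 1)) s + pos x (wt n) (s' + p)) ∧
      (∀ n, pos x (wt n) t' + extR n (!br) = pos x (wt (n + 1)) t + extR (n + 1) br) ∧
      (∀ n, extL n bl' + pos x (wt (n + 1)) s ≤ pos x (wt n) s' + extL (n + 1) bl) ∧
      (1 ≤ s → 1 ≤ s' ∧ bl' = (!bl) ∧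
        ∀ n, extL n bl' + pos x (wt (n + 1)) s = pos x (wt n) s' + extL (n + 1) bl) := by
  have hF2 := two_mul_le_F
  obtain ⟨s', hrun, hr', hs', hcase⟩ := h.lift hF hl hr
  have hright : ∀ n, pos x (wt n) (F t + 1 + br.toNat) + extR n (!br) =
      pos x (wt (n + 1)) t + extR (n + 1) br := by
    intro n
    have h0 : x (F t) = 0 := x_F t
    rw [pos_wt_succ]
    cases hbr : br
    · simp [pos_succ, h0, extR, add_assoc]
    · have hne := hr.symm.trans hbr
      simp only [decide_eq_true_eq] at hne
      have key : ∀ a : Letter, a ≠ 0 → (f a ++ [0]).getD 1 0 = 2 := by decide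
      have h1 := (x_F_add_lt_three t 1 (by decide)).trans (key _ hne.1)
      simp [pos_succ, h0, h1, extR, add_assoc]
  have hroot : ∀ n, pos x (wt (n + 1)) (s + q) + pos x (wt n) s' =
      pos x (wt (n + 1)) s + pos x (wt n) (s' + p) := by
    intro n
    have hle := pos_mono x (fun a => (f a).length) h.le
    have := hrun.isMatch.pos_add (wt n) hs' (by simp only [F]; omega)
    rw [pos_wt_succ, pos_wt_succ, hF, this]
  have hleft : 1 ≤ s → ∀ n, extL n (!bl) + pos x (wt (n + 1)) s =
      pos x (wt n) s' + extL (n + 1) bl := by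
    intro hs n
    rcases hcase with ⟨rfl, _⟩ | ⟨h1, h2⟩
    · omega
    · rw [pos_wt_succ, h1]
      cases hbl : bl
      · simp [extL, add_comm]
      · rcases hl with ⟨_, h⟩ | ⟨j, rfl, hb⟩
        · simp [hbl] at h
        rw [hbl] at hb h1
        have hne := hb.symm
        simp only [decide_eq_true_eq] at hne
        have key : ∀ a : Letter, a ≠ 0 → (f a).reverse.getD 0 0 = 2 := by decide
        obtain ⟨N, hN, -, hN1⟩ := x_F_succ_sub j
        rw [key _ hne.1] at hN1
        have : s' = N + 1 := by simp at h1; omega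
        rw [this]
        simp [pos_succ, extL, hN1]
        ring
  -- A run at the left end of `x` has no left mismatch: its type stays `false` by convention, and
  -- only the inequality for `extL` survives.
  refine ⟨s', F t + 1 + br.toNat, if s = 0 then false else !bl, hrun, ?_, hr', hs', by omega,
    hroot, hright, ?_, ?_⟩
  · rcases hcase with ⟨rfl, rfl, rfl⟩ | ⟨h1, h2⟩
    · exact .inl ⟨rfl, rfl⟩
    · by_cases hs0 : s = 0
      · subst hs0
        have h1' : 0 = s' + bl.toNat := h1
        exact .inl ⟨by omega, rfl⟩
      · simpa [hs0] using h2
  · intro n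
    by_cases hs0 : s = 0
    · subst hs0
      have : s' = 0 := by simpa using hs'
      subst this
      have := extL_le n
      cases bl <;> simp [extL, this.1]
    · simpa [hs0] using (hleft (by omega) n).le
  · intro hs
    have hs0 : s ≠ 0 := by omega
    simp only [hs0, if_false]
    refine ⟨?_, trivial, hleft hs⟩
    rcases hcase with ⟨rfl, _⟩ | ⟨h1, h2⟩
    · omega
    · have := hF2 s
      have := Bool.toNat_le bl
      omega

/-! ### Short factors of `x` -/

/-- The word `u` occurs in `w` at position `i`. -/
def OccursAt (u : List Letter) (w : ℕ → Letter) (i : ℕ) : Prop :=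
  ∀ j < u.length, w (i + j) = u.getD j 0

theorem getD_append (a b : List Letter) (k : ℕ) :
    (k < a.length → (a ++ b).getD k 0 = a.getD k 0) ∧
    (a ++ b).getD (a.length + k) 0 = b.getD k 0 := by
  constructor
  · intro h
    simp [List.getElem?_append_left h]
  · simp [List.getElem?_append_right]

theorem OccursAt.append {a b : List Letter} {w : ℕ → Letter} {i : ℕ} (ha : OccursAt a w i)
    (hb : OccursAt b w (i + a.length)) : OccursAt (a ++ b) w i := by
  intro j hj
  by_cases h : j < a.length
  · rw [ha j h, (getD_append a b j).1 h]
  · obtain ⟨k, rfl⟩ := Nat.exists_eq_add_of_le (not_lt.1 h)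
    rw [(getD_append a b k).2, ← add_assoc, hb k (by simp at hj; omega)]

theorem OccursAt.tail {a : Letter} {u : List Letter} {w : ℕ → Letter} {i : ℕ}
    (h : OccursAt (a :: u) w i) : w i = a ∧ OccursAt u w (i + 1) :=
  ⟨h 0 (by simp), fun j hj => by
    have := h (j + 1) (by simpa using hj)
    rw [show i + (j + 1) = i + 1 + j by ring] at this
    simpa using this⟩

theorem OccursAt.drop_take {u : List Letter} {w : ℕ → Letter} {i : ℕ} (h : OccursAt u w i)
    (k n : ℕ) : OccursAt ((u.drop k).take n) w (i + k) := by
  intro j hj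
  simp only [List.length_take, List.length_drop] at hj
  rw [add_assoc, h (k + j) (by omega)]
  simp only [List.getD_eq_getElem?_getD, List.getElem?_take, List.getElem?_drop]
  rw [if_pos (by omega)]

theorem OccursAt.f {u : List Letter} {m : ℕ} (h : OccursAt u x m) :
    OccursAt (applyMorphism f u) x (F m) := by
  induction u generalizing m with
  | nil => exact fun j hj => absurd hj (by simp [applyMorphism])
  | cons a u ih =>
    obtain ⟨h1, h2⟩ := h.tail
    have := ih h2
    rw [F_succ, h1] at this
    exact OccursAt.append (fun j hj => by rw [x_F_add m j (by rwa [h1]), h1]) this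

/-- The factors of length six of `x`. -/
def factorsSix : List (List Letter) :=
  [[0, 1, 0, 2, 0, 1], [0, 1, 0, 2, 0, 2], [0, 1, 0, 2, 2, 0], [0, 2, 0, 1, 0, 2],
   [0, 2, 0, 2, 0, 1], [0, 2, 2, 0, 1, 0], [1, 0, 2, 0, 1, 0], [1, 0, 2, 0, 2, 0],
   [1, 0, 2, 2, 0, 1], [2, 0, 1, 0, 2, 0], [2, 0, 1, 0, 2, 2], [2, 0, 2, 0, 1, 0],
   [2, 2, 0, 1, 0, 2]]

theorem occursAt_zero : OccursAt [0, 1, 0, 2, 2, 0] x 0 := by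
  have h : OccursAt [0] x 0 := fun j hj => by
    obtain rfl : j = 0 := by simpa using hj
    exact x_zero
  have h3 := h.f.f.f
  have e : F (F (F 0)) = 0 := rfl
  rw [e] at h3
  exact h3.drop_take 0 6

/-- The six letters at `n > 0` lie in the image of the six letters at some `m < n`, and the list is
closed under this operation. -/
theorem exists_factorsSix (n : ℕ) : ∃ u ∈ factorsSix, OccursAt u x n := by
  induction n using Nat.strong_induction_on with
  | _ n ih =>
  rcases n.eq_zero_or_pos with rfl | hn
  · exact ⟨_, by decide, occursAt_zero⟩
  obtain ⟨m, k, hmk, hk⟩ := exists_pos_add x (fun a => (f a).length)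
    (fun a => (by decide : 1 ≤ 2).trans (two_le_length_f a)) n
  rw [← F] at hmk
  have hm := two_mul_le_F m
  obtain ⟨u, hu, ho⟩ := ih m (by omega)
  have key : ∀ u ∈ factorsSix, 0 < u.length ∧ ∀ k < (f (u.getD 0 0)).length,
      ((applyMorphism f u).drop k).take 6 ∈ factorsSix := by decide
  have h0 := ho 0 (key u hu).1
  rw [add_zero] at h0
  refine ⟨_, (key u hu).2 k (by rwa [← h0]), ?_⟩
  rw [hmk]
  exact ho.f.drop_take k 6

theorem exists_letters (n : ℕ) : ∃ u ∈ factorsSix, x n = u.getD 0 0 ∧ x (n + 1) = u.getD 1 0 ∧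
    x (n + 2) = u.getD 2 0 := by
  obtain ⟨u, hu, ho⟩ := exists_factorsSix n
  have key : ∀ u ∈ factorsSix, u.length = 6 := by decide
  have := key u hu
  exact ⟨u, hu, ho 0 (by omega), ho 1 (by omega), ho 2 (by omega)⟩

theorem eq_zero_of_three (n : ℕ) : x n = 0 ∨ x (n + 1) = 0 ∨ x (n + 2) = 0 := by
  obtain ⟨u, hu, h0, h1, h2⟩ := exists_letters n
  have key : ∀ u ∈ factorsSix, u.getD 0 0 = 0 ∨ u.getD 1 0 = 0 ∨ u.getD 2 0 = 0 := by decide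
  rw [h0, h1, h2]
  exact key u hu

theorem eq_two_of_ne_zero {n : ℕ} (h : x n ≠ 0) (h' : x (n + 1) ≠ 0) :
    x n = 2 ∧ x (n + 1) = 2 := by
  obtain ⟨u, hu, h0, h1, h2⟩ := exists_letters n
  have key : ∀ u ∈ factorsSix, u.getD 0 0 ≠ 0 → u.getD 1 0 ≠ 0 →
    u.getD 0 0 = 2 ∧ u.getD 1 0 = 2 := by decide
  rw [h0] at h ⊢
  rw [h1] at h' ⊢
  exact key u hu h h'

theorem eq_one_or_two {a : Letter} (h : a ≠ 0) : a = 1 ∨ a = 2 := by revert a; decide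

/-! ### The inequality for runs of `x` -/

/-- The weights of a run of `x` with no letter `0` in its window. -/
theorem Run.weights_of_ne_zero {s t p : ℕ} {bl br : Bool} (h : Run x s t p)
    (hl : LType s p bl) (hr : RType t p br) (hp : 1 ≤ p) (hpar : par (s + p) = par s)
    (h0 : ∀ j, s ≤ j → j < t → x j ≠ 0) (n : ℕ) :
    (t = s ∧ bl = false ∧ br = false ∧ pos x (wt n) s + wt n 0 ≤ pos x (wt n) (s + p)) ∨
    (t = s ∧ pos x (wt n) s + 2 * wt n 2 ≤ pos x (wt n) (s + p)) ∨
    (pos x (wt n) t ≤ pos x (wt n) s + wt n 2 ∧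
      pos x (wt n) s + (wt n 0 + 2 * wt n 2) ≤ pos x (wt n) (s + p)) := by
  have hwt := wt_bounds n
  -- In `x`, both `1` and `22` are always preceded by `0`.
  have prev : ∀ k, x k ≠ 0 → (x k = 1 ∨ x (k + 1) ≠ 0) → ∃ j, k = j + 1 ∧ x j = 0 := by
    intro k hk hk'
    rcases k with _ | j
    · exact absurd x_zero hk
    refine ⟨j, rfl, ?_⟩
    by_contra hj
    rcases hk' with hk' | hk'
    · have := (eq_two_of_ne_zero hj hk).2
      rw [hk'] at this
      exact absurd this (by decide)
    · have := eq_zero_of_three j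
      tauto
  -- If both copies begin with such a word, the common preceding `0` extends the match to the left,
  -- against maximality. So the window is empty or the single letter `2`.
  have noprev : ∀ k, s = k → x k ≠ 0 → (x k = 1 ∨ x (k + 1) ≠ 0) →
      (x (k + p) = 1 ∨ x (k + p + 1) ≠ 0) → x k = x (k + p) → False := by
    rintro k rfl hk hk1 hk2 he
    obtain ⟨i, rfl, hi0⟩ := prev s hk hk1
    obtain ⟨i', hi', hi0'⟩ := prev (i + 1 + p) (by rwa [← he]) hk2
    obtain rfl : i' = i + p := by omega
    exact h.left i rfl (by rw [hi0, hi0'])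
  have hle := h.le
  have hts : t ≤ s + 1 := by
    by_contra! hlt
    have e0 := h.isMatch s le_rfl (by omega)
    have e1 := h.isMatch (s + 1) (by omega) (by omega)
    have n0 := h0 s le_rfl (by omega)
    have n1 := h0 (s + 1) (by omega) (by omega)
    rw [show s + 1 + p = s + p + 1 by ring] at e1
    exact noprev s rfl n0 (.inr n1) (.inr (by rwa [← e1])) e0
  have hs2 : t = s + 1 → x s = 2 ∧ x (s + p) = 2 := by
    rintro rfl
    have e0 := h.isMatch s le_rfl (by omega)
    have n0 := h0 s le_rfl (by omega)
    rcases eq_one_or_two n0 with h1 | h1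
    · exact (noprev s rfl n0 (.inl h1) (.inl (by rw [← e0, h1])) e0).elim
    · exact ⟨h1, by rw [← e0, h1]⟩
  have hV : pos x (wt n) t ≤ pos x (wt n) s + wt n 2 := by
    rcases (show t = s ∨ t = s + 1 by omega) with rfl | ht
    · omega
    · rw [ht, pos_succ, (hs2 ht).1]
  rcases (show p = 1 ∨ p = 2 ∨ 3 ≤ p by omega) with rfl | rfl | hp3
  · left
    -- A shift across a single `2` would change the transducer state.
    have hx2 : x s ≠ 2 := by
      intro h2
      rw [par, h2] at hpar
      revert hpar
      cases par s <;> decide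
    have hts' : t = s := by
      by_contra hne
      exact hx2 (hs2 (by omega)).1
    subst hts'
    rw [pos_succ]
    by_cases hx0 : x t = 0
    · refine ⟨rfl, ?_, ?_, by rw [hx0]⟩
      · rcases hl with ⟨_, hl⟩ | ⟨j, rfl, hl⟩
        · exact hl
        · simpa [hx0] using hl
      · simpa [RType, hx0] using hr
    · have hx1 : x t = 1 := (eq_one_or_two hx0).resolve_right hx2
      obtain ⟨j, rfl, hj⟩ := prev t hx0 (.inl hx1)
      have hnext : x (j + 1 + 1) = 0 := by
        by_contra hne
        exact hx2 (eq_two_of_ne_zero hx0 hne).1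
      refine ⟨rfl, ?_, ?_, by rw [hx1]; omega⟩
      · rcases hl with ⟨hl, _⟩ | ⟨i, hi, hl⟩
        · omega
        · obtain rfl : i = j := by omega
          simpa [hj] using hl
      · simpa [RType, hnext] using hr
  · right; left
    have hts' : t = s := by
      by_contra hne
      obtain ⟨h1, h2⟩ := hs2 (by omega)
      rw [show s + 2 = s + 1 + 1 by ring, par, par, h1] at hpar
      have h3 := eq_zero_of_three s
      by_cases hx : x (s + 1) = 2
      · rw [h1, h2, hx] at h3
        revert h3; decide
      · rw [flip, if_neg hx] at hpar
        revert hpar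
        cases par s <;> decide
    refine ⟨hts', ?_⟩
    have := wt_two_le n (x s)
    have := wt_two_le n (x (s + 1))
    rw [show s + 2 = s + 1 + 1 by ring, pos_succ, pos_succ]
    omega
  · right; right
    -- Three consecutive letters include a `0`, and the other two weigh at least `wt n 2` each.
    refine ⟨hV, ?_⟩
    have hmono := pos_mono x (wt n) (show s + 3 ≤ s + p by omega)
    have e : pos x (wt n) (s + 3) =
        pos x (wt n) s + wt n (x s) + wt n (x (s + 1)) + wt n (x (s + 2)) := by
      rw [pos_succ, pos_succ, pos_succ]
    have := wt_two_le n (x s)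
    have := wt_two_le n (x (s + 1))
    have := wt_two_le n (x (s + 2))
    rcases eq_zero_of_three s with h3 | h3 | h3
    all_goals
      rw [h3] at e
      omega

/-- Induction on the window length, for all levels at once: a run with a `0` in its window is
desubstituted, which raises `n` by one and preserves the weighted period without decreasing the
extended length. The three hypotheses on `C` are the three outcomes of `Run.weights_of_ne_zero`. -/
theorem Run.bound {C : ℝ}
    (h1 : ∀ n, ((extL n false + extR n false : ℕ) : ℝ) ≤ C * (wt n 0 : ℕ))
    (h2 : ∀ n, ((extL n true + extR n true : ℕ) : ℝ) ≤ C * (2 * wt n 2 : ℕ))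
    (h3 : ∀ n, ((wt n 2 + extL n true + extR n true : ℕ) : ℝ) ≤ C * (wt n 0 + 2 * wt n 2 : ℕ))
    (hC : 0 ≤ C) {s t p : ℕ} {bl br : Bool} (h : Run x s t p)
    (hl : LType s p bl) (hr : RType t p br) (hp : 1 ≤ p) (hpar : par (s + p) = par s) (n : ℕ) :
    (pos x (wt n) t : ℝ) - pos x (wt n) s + extL n bl + extR n br ≤
      C * (pos x (wt n) (s + p) - pos x (wt n) s) := by
  induction hd : t - s using Nat.strong_induction_on generalizing s t p bl br n with
  | _ d ih =>
  by_cases hz : ∃ j, s ≤ j ∧ j < t ∧ x j = 0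
  · obtain ⟨j, hsj, hjt, hj⟩ := hz
    -- The `0` and its copy are both cutting points, so the run through the corresponding indices
    -- lifts to a run meeting the given one, hence equal to it.
    obtain ⟨a, rfl⟩ := exists_F_eq hj
    obtain ⟨b, hb⟩ := exists_F_eq (j := F a + p) (by rw [← h.isMatch _ hsj hjt, hj])
    have hab : a < b := by
      by_contra! hle
      have := pos_mono x (fun a => (f a).length) hle
      rw [← F, ← F] at this
      omega
    obtain ⟨k, rfl⟩ := Nat.exists_eq_add_of_lt hab
    obtain ⟨s', t', hsa, hat, hrun⟩ := exists_run a (k + 1) (by omega)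
    have hF : F (s' + (k + 1)) = F s' + p :=
      hrun.F_add hb.symm hsa hat le_rfl hrun.le
    obtain ⟨bl', hl'⟩ := exists_LType s' (k + 1)
    have hr' : RType t' (k + 1) _ := rfl
    obtain ⟨s₂, t₂, bl₂, hrun₂, hl₂, hr₂, hs₂, ht₂, hroot, hright, hleft, -⟩ :=
      hrun.lift_wt hF hl' hr'
    have hFs : F s' ≤ F a := pos_mono _ _ hsa
    have hFt : F a ≤ F t' := pos_mono _ _ hat
    obtain ⟨rfl, rfl⟩ := h.eq_of_mem hrun₂ hsj hjt.le (by omega) (by omega)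
    have hbl : bl = bl₂ := by
      rcases hl with ⟨h1, h2⟩ | ⟨j, h1, h2⟩ <;> rcases hl₂ with ⟨h3, h4⟩ | ⟨j', h3, h4⟩
      · rw [h2, h4]
      · omega
      · omega
      · obtain rfl : j = j' := by omega
        rw [h2, h4]
    subst hbl
    have hbr := hr.trans hr₂.symm
    rw [hbr]
    have hpar' : par (s' + (k + 1)) = par s' := by
      have e := hrun₂.isMatch.par_add (m := F s') (by omega) (by omega)
      rw [← hF, par_F, par_F] at e
      exact e.2 hpar
    have hlt : t' - s' < d := by
      obtain ⟨i, rfl⟩ := Nat.exists_eq_add_of_le hrun.le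
      have := F_add_two_mul_le s' i
      omega
    have := ih _ hlt hrun hl' hr' (by omega) hpar' (n + 1) rfl
    have e1 := hroot n
    have e2 := hright n
    have e3 := hleft n
    rify at e1 e2 e3
    have e4 : (pos x (wt n) (s + p) : ℝ) - pos x (wt n) s =
      pos x (wt (n + 1)) (s' + (k + 1)) - pos x (wt (n + 1)) s' := by linarith
    rw [e4]
    linarith
  · push Not at hz
    have hL := extL_le_true n bl
    have hR := extR_le_true n br
    have hW := h.weights_of_ne_zero hl hr hp hpar hz n
    have a1 := h1 n
    have a2 := h2 n
    have a3 := h3 n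
    rify at hL hR a1 a2 a3
    rcases hW with ⟨rfl, rfl, rfl, hW⟩ | ⟨rfl, hW⟩ | ⟨hV, hW⟩ <;> rify at *
    · have : C * (wt n 0 : ℝ) ≤ C * (pos x (wt n) (t + p) - pos x (wt n) t) :=
        mul_le_mul_of_nonneg_left (by linarith) hC
      linarith
    · have : C * (2 * (wt n 2 : ℝ)) ≤ C * (pos x (wt n) (t + p) - pos x (wt n) t) :=
        mul_le_mul_of_nonneg_left (by linarith) hC
      linarith
    · have : C * (wt n 0 + 2 * (wt n 2 : ℝ)) ≤ C * (pos x (wt n) (s + p) - pos x (wt n) s) :=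
        mul_le_mul_of_nonneg_left (by linarith) hC
      linarith

/-! ### Lifting runs from `x` to `z` -/

theorem wt_zero_bounds (a : Letter) : 16 ≤ wt 0 a ∧ wt 0 a ≤ 24 := by revert a; decide

theorem one_le_wt_zero (a : Letter) : 1 ≤ wt 0 a := by revert a; decide

theorem Z_succ (m : ℕ) : Z (m + 1) = Z m + wt 0 (x m) := pos_succ _ _ _

theorem Z_mono : Monotone Z := pos_mono _ _

/-- The letters of `z` from the start of a block up to the sixteenth letter of the next one. -/
theorem z_Z_add_lt (m k : ℕ) (hk : k < wt 0 (x m) + 16) :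
    z (Z m + k) = (block (par m) (x m) ++ T (par (m + 1)) 2).getD k 0 := by
  by_cases h : k < wt 0 (x m)
  · rw [z_Z_add m k h, (getD_append _ _ _).1 (by rwa [length_block])]
  · obtain ⟨i, rfl⟩ := Nat.exists_eq_add_of_le (not_lt.1 h)
    have h16 := wt_zero_bounds (x (m + 1))
    rw [← add_assoc, ← Z_succ, z_Z_add _ _ (by omega), ← block_getD_left _ _ _ (by omega),
      ← length_block (par m) (x m), (getD_append _ _ _).2]

/-- The last sixteen letters of a block. -/
theorem z_Z_succ_sub (m : ℕ) : ∃ N, Z (m + 1) = N + 16 ∧ ∀ k < 16,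
    z (N + k) = ((block (par m) (x m)).drop (wt 0 (x m) - 16)).getD k 0 := by
  have h16 := wt_zero_bounds (x m)
  refine ⟨Z m + (wt 0 (x m) - 16), by rw [Z_succ]; omega, fun k hk => ?_⟩
  rw [add_assoc, z_Z_add _ _ (by omega)]
  simp [List.getElem?_drop]

/-- All blocks in one state share their first 16 letters. After these, `{1,2}` agree on 8 + 2
further letters, and pairs involving `0` on 3 + 1. -/
theorem extR_zero_spec : ∀ (e : Bool) (c d : Letter), c ≠ d → ∀ b : Bool,
    b = decide (c ≠ 0 ∧ d ≠ 0) →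
    (∀ k < extR 0 b, (block e c ++ T (flip e c) 2).getD k 0 =
      (block e d ++ T (flip e d) 2).getD k 0) ∧
    (block e c ++ T (flip e c) 2).getD (extR 0 b) 0 ≠
      (block e d ++ T (flip e d) 2).getD (extR 0 b) 0 := by
  decide +kernel

/-- On the left it is the states after the blocks that agree. The common suffix is then the 8
letters of the output of `1` for `{1,2}`, and 2 letters if `0` is involved. -/
theorem extL_zero_spec : ∀ (e e' : Bool) (c d : Letter), c ≠ d → flip e c = flip e' d →
    ∀ b : Bool, b = decide (c ≠ 0 ∧ d ≠ 0) →
    (∀ k < 16, 16 - extL 0 b ≤ k → ((block e c).drop (wt 0 c - 16)).getD k 0 =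
      ((block e' d).drop (wt 0 d - 16)).getD k 0) ∧
    ((block e c).drop (wt 0 c - 16)).getD (15 - extL 0 b) 0 ≠
      ((block e' d).drop (wt 0 d - 16)).getD (15 - extL 0 b) 0 := by
  decide +kernel

theorem Run.Z_add {s t p q m m' : ℕ} (h : Run x s t q) (hZ : Z (m + q) = Z m + p) (hs : s ≤ m)
    (hm : m ≤ t) (hs' : s ≤ m') (hm' : m' ≤ t) : Z (m' + q) = Z m' + p := by
  have h1 := h.isMatch.pos_add (wt 0) hs hm
  have h2 := h.isMatch.pos_add (wt 0) hs' hm'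
  simp only [Z] at *
  omega

theorem Run.match_Z {s t p q : ℕ} (h : Run x s t q) (hZ : Z (s + q) = Z s + p)
    (hpar : par (s + q) = par s) : Match z (Z s) (Z t) p := by
  intro j h1 h2
  obtain ⟨m, k, rfl, hk⟩ := exists_pos_add x (wt 0) one_le_wt_zero j
  rw [← Z] at h1 h2
  have hms : s ≤ m := by
    by_contra! hlt
    have := Z_mono (Nat.succ_le_of_lt hlt)
    rw [Nat.succ_eq_add_one, Z_succ] at this
    omega
  have hmt : m < t := by
    by_contra! hle
    have := Z_mono hle
    omega
  have e : Z m + k + p = Z (m + q) + k := by rw [h.Z_add hZ le_rfl h.le hms hmt.le]; ring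
  change z (Z m + k) = z (Z m + k + p)
  rw [e, z_Z_add m k hk, z_Z_add (m + q) k (by rwa [← h.isMatch m hms hmt]),
    h.isMatch m hms hmt, (h.isMatch.par_add hms hmt.le).2 hpar]

/-- The image of a run of `x` under `τ ∘ g`. -/
theorem Run.lift_z {s t p q : ℕ} {bl br : Bool} (h : Run x s t q) (hZ : Z (s + q) = Z s + p)
    (hpar : par (s + q) = par s) (hl : LType s q bl) (hr : RType t q br) :
    ∃ S, Run z S (Z t + extR 0 br) p ∧ S ≤ Z s ∧ Z s ≤ S + extL 0 bl ∧
      (1 ≤ s → Z s = S + extL 0 bl) := by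
  have hst : Z s ≤ Z t := Z_mono h.le
  have hright : Match z (Z t) (Z t + extR 0 br) p ∧
      z (Z t + extR 0 br) ≠ z (Z t + extR 0 br + p) := by
    obtain ⟨k1, k2⟩ := extR_zero_spec (par t) _ _ h.right br hr
    have hpt := (h.isMatch.par_add h.le le_rfl).2 hpar
    have hZt := h.Z_add hZ le_rfl h.le h.le le_rfl
    have hbr : extR 0 br ≤ 26 := by cases br <;> decide
    have e1 : ∀ k ≤ 26, z (Z t + k) = (block (par t) (x t) ++ T (flip (par t) (x t)) 2).getD k 0 :=
      fun k hk => z_Z_add_lt t k (by have := wt_zero_bounds (x t); omega)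
    have e2 : ∀ k ≤ 26, z (Z t + k + p) =
        (block (par t) (x (t + q)) ++ T (flip (par t) (x (t + q))) 2).getD k 0 := by
      intro k hk
      have := z_Z_add_lt (t + q) k (by have := wt_zero_bounds (x (t + q)); omega)
      rw [par, hpt, hZt] at this
      rw [← this]
      congr 1
      ring
    constructor
    · intro j hj1 hj2
      obtain ⟨k, rfl⟩ := Nat.exists_eq_add_of_le hj1
      rw [e1 k (by omega), e2 k (by omega)]
      exact k1 k (by omega)
    · rw [e1 _ hbr, e2 _ hbr]
      exact k2
  rcases hl with ⟨rfl, rfl⟩ | ⟨j, rfl, hb⟩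
  · exact ⟨0, ⟨by omega, (h.match_Z hZ hpar).append hright.1, fun j hj => absurd hj (by omega),
      hright.2⟩, by omega, by simp, fun h => absurd h (by omega)⟩
  · obtain ⟨N, hN, e1⟩ := z_Z_succ_sub j
    obtain ⟨N', hN', e2⟩ := z_Z_succ_sub (j + q)
    have hNN : N' = N + p := by
      rw [show j + q + 1 = j + 1 + q by ring] at hN'
      omega
    subst hNN
    have hpj : flip (par j) (x j) = flip (par (j + q)) (x (j + q)) := by
      rw [show j + 1 + q = j + q + 1 by ring] at hpar
      exact hpar.symm
    obtain ⟨k1, k2⟩ := extL_zero_spec _ _ _ _ (h.left j rfl) hpj bl hb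
    have hbl : extL 0 bl ≤ 8 := by cases bl <;> decide
    refine ⟨N + (16 - extL 0 bl), ⟨by omega, ?_, ?_, hright.2⟩, by omega, by omega,
      fun _ => by omega⟩
    · refine Match.append (b := Z (j + 1)) ?_ ((h.match_Z hZ hpar).append hright.1)
      intro i hi1 hi2
      obtain ⟨k, rfl⟩ := Nat.exists_eq_add_of_le (show N ≤ i by omega)
      rw [e1 k (by omega), show N + k + p = N + p + k by ring, e2 k (by omega)]
      exact k1 k (by omega) (by omega)
    · intro i hi
      obtain rfl : i = N + (15 - extL 0 bl) := by omega
      rw [e1 _ (by omega), show N + (15 - extL 0 bl) + p = N + p + (15 - extL 0 bl) by ring,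
        e2 _ (by omega)]
      exact k2

/-! ### Synchronization in `z` -/

/-- The letter that precedes a block, followed by the first eleven letters of the block. -/
def marker (e : Bool) : List Letter := (if e then 2 else 1) :: (T e 2).take 11

theorem length_marker (e : Bool) : (marker e).length = 12 := by revert e; decide

theorem occursAt_marker {m N : ℕ} (hN : N + 1 = Z (m + 1)) :
    OccursAt (marker (par (m + 1))) z N := by
  have key : ∀ e a, ∀ k < 12, (marker (flip e a)).getD k 0 =
      (block e a ++ T (flip e a) 2).getD (wt 0 a - 1 + k) 0 := by decide +kernel
  intro k hk
  rw [length_marker] at hk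
  have h16 := wt_zero_bounds (x m)
  rw [Z_succ] at hN
  rw [show N + k = Z m + (wt 0 (x m) - 1 + k) by omega, z_Z_add_lt _ _ (by omega), par, key _ _ k hk]

/-- A finite check over all offsets in a block: the marker reveals block boundaries and the
transducer state. -/
theorem OccursAt.eq_Z {e : Bool} {N : ℕ} (h : OccursAt (marker e) z N) :
    ∃ a, N + 1 = Z a ∧ par a = e := by
  obtain ⟨m, k, hmk, hk⟩ := exists_pos_add x (wt 0) one_le_wt_zero (N + 1)
  rw [← Z] at hmk
  have h16 := wt_zero_bounds (x m)
  have hlen := length_marker e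
  rcases k with _ | k
  · refine ⟨m, hmk, ?_⟩
    -- The third letter of a block, `1` or `2`, shows the state; the index in the marker is one
    -- larger because of the preceding letter.
    have key : ∀ e e' a, (block e' a).getD 2 0 = (marker e).getD 3 0 → e' = e := by
      decide +kernel
    apply key e _ (x m)
    rw [← h 3 (by omega), ← z_Z_add m 2 (by omega)]
    congr 1
    omega
  · exfalso
    have key : ∀ e e' a, ∀ k < 24, k + 1 < wt 0 a →
        ¬ ∀ j < 12, (block e' a ++ T (flip e' a) 2).getD (k + j) 0 = (marker e).getD j 0 := by
      decide +kernel
    refine key e (par m) (x m) k (by omega) hk fun j hj => ?_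
    rw [← h j (by omega), ← par, ← z_Z_add_lt m _ (by omega)]
    congr 1
    omega

/-- A long match in `z` is contained in the image of a run of `x`. -/
theorem Match.exists_run_z {S N p : ℕ} (h : Match z S N p) (hp : 1 ≤ p) (hlen : S + 35 ≤ N) :
    ∃ s t q bl br, Run x s t q ∧ LType s q bl ∧ RType t q br ∧ 1 ≤ q ∧ par (s + q) = par s ∧
      Z (s + q) = Z s + p ∧ N + Z s ≤ S + Z t + extL 0 bl + extR 0 br := by
  obtain ⟨m, k, hmk, hk⟩ := exists_pos_add x (wt 0) one_le_wt_zero S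
  rw [← Z] at hmk
  have h16 := wt_zero_bounds (x m)
  have hZ1 := Z_succ m
  -- The next boundary is at most 24 letters after `S`, and the marker reaches 11 letters beyond it,
  -- whence 35.
  obtain ⟨M, hM⟩ : ∃ M, M + 1 = Z (m + 1) := ⟨Z (m + 1) - 1, by omega⟩
  have ho := occursAt_marker hM
  have hlenm := length_marker (par (m + 1))
  have ho' : OccursAt (marker (par (m + 1))) z (M + p) := by
    intro j hj
    rw [← ho j hj, h (M + j) (by omega) (by omega)]
    congr 1
    ring
  obtain ⟨b, hb, hpb⟩ := ho'.eq_Z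
  generalize m + 1 = a at *
  have hab : a < b := by
    by_contra! hle
    have := Z_mono hle
    omega
  obtain ⟨i, rfl⟩ := Nat.exists_eq_add_of_lt hab
  obtain ⟨s, t, hsa, hat, hrun⟩ := exists_run a (i + 1) (by omega)
  have hZ : Z (s + (i + 1)) = Z s + p :=
    hrun.Z_add (m := a) (by rw [← add_assoc]; omega) hsa hat le_rfl hrun.le
  have hpar : par (s + (i + 1)) = par s := (hrun.isMatch.par_add hsa hat).1 hpb
  obtain ⟨bl, hl⟩ := exists_LType s (i + 1)
  obtain ⟨S', hrun', hS1, hS2, -⟩ := hrun.lift_z hZ hpar hl rfl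
  have hZs := Z_mono hsa
  have hZt := Z_mono hat
  have := hrun'.contains h (c := Z a) (by omega) (by omega) (by omega) (by omega)
  exact ⟨s, t, i + 1, bl, _, hrun, hl, rfl, by omega, hpar, hZ, by omega⟩

/-! ### Exclusion of short repetitions -/

/-- The image of a finite word under `τ ∘ g`, at a position of parity `e`. -/
def blocks : Bool → List Letter → List Letter
  | _, [] => []
  | e, a :: u => block e a ++ blocks (flip e a) u

theorem OccursAt.blocks {u : List Letter} {m : ℕ} (h : OccursAt u x m) :
    OccursAt (blocks (par m) u) z (Z m) := by
  induction u generalizing m with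
  | nil => exact fun j hj => absurd hj (by simp [RichWord.blocks])
  | cons a u ih =>
    obtain ⟨h1, h2⟩ := h.tail
    have := ih h2
    rw [Z_succ, par, h1, ← length_block (par m)] at this
    refine OccursAt.append (fun j hj => ?_) this
    rw [length_block] at hj
    rw [z_Z_add m j (by rwa [h1]), h1]

theorem OccursAt.eq_of_match {u v : List Letter} {w : ℕ → Letter} {i p : ℕ} (hu : OccursAt u w i)
    (hv : OccursAt v w (i + p)) (hlen : u.length = v.length) (hm : Match w i (i + u.length) p) :
    u = v := by
  apply List.ext_getElem hlen
  intro j h1 h2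
  have a := hu j h1
  have b := hv j h2
  rw [List.getD_eq_getElem _ _ h1] at a
  rw [List.getD_eq_getElem _ _ h2] at b
  rw [← a, ← b, hm _ (by omega) (by omega)]
  congr 1
  ring

/-- The least length that exceeds `1.2587 * p`. -/
def shortLen (p : ℕ) : ℕ := 12587 * p / 10000 + 1

/-- Offsets below 24 reach every position of the first block, and `84 = 23 + 27 + 34` letters
suffice for the largest offset, period and length. -/
theorem blocks_ne : ∀ u ∈ factorsSix, ∀ e : Bool,
    84 < (blocks e u).length ∧ ∀ k < 24, ∀ p < 27,
      ((blocks e u).drop k).take (shortLen (p + 1)) ≠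
        ((blocks e u).drop (k + (p + 1))).take (shortLen (p + 1)) := by
  decide +kernel

theorem not_match_short {p : ℕ} (hp : 1 ≤ p) (hp' : p ≤ 27) (N : ℕ) :
    ¬ Match z N (N + shortLen p) p := by
  intro h
  obtain ⟨m, k, hmk, hk⟩ := exists_pos_add x (wt 0) one_le_wt_zero N
  rw [← Z] at hmk
  have h16 := wt_zero_bounds (x m)
  obtain ⟨u, hu, ho⟩ := exists_factorsSix m
  obtain ⟨hlen, hne⟩ := blocks_ne u hu (par m)
  obtain ⟨p, rfl⟩ := Nat.exists_eq_add_of_le' hp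
  have hs : shortLen (p + 1) ≤ 34 := by unfold shortLen; omega
  refine hne k (by omega) p (by omega) (OccursAt.eq_of_match (ho.blocks.drop_take k _)
    (p := p + 1) ?_ (by simp; omega) ?_)
  · rw [add_assoc]
    exact ho.blocks.drop_take _ _
  · rw [← hmk]
    refine fun j h1 h2 => h j h1 ?_
    simp at h2
    omega

/-! ### Asymptotics of the extensions and the critical family -/

/-- Closed forms of the total extensions of the two kinds of runs. -/
theorem ext_eq (n : ℕ) :
    4 * (extL n false + extR n false) + (if Even n then 9 else 3) =
      3 * wt n 0 + wt n 1 + wt n 2 ∧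
    4 * (extL n true + extR n true) + (if Even n then 3 else 9) =
      wt n 0 + 3 * wt n 1 + 3 * wt n 2 := by
  induction n with
  | zero => decide
  | succ n ih =>
    have e0 : wt (n + 1) 0 = wt n 0 + wt n 1 := rfl
    have e1 : wt (n + 1) 1 = wt n 0 + 2 * wt n 2 := rfl
    have e2 : wt (n + 1) 2 = wt n 0 + wt n 2 := rfl
    simp only [extL, extR, Nat.even_add_one, e0, e1, e2, Bool.false_eq_true, if_true, if_false]
    split_ifs at ih ⊢ <;> omega

/-- The weights obey a linear recurrence with characteristic polynomial `X³ - 2X² - 1`. The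
functional `d` vanishes on the eigenvector of `μ`, so it obeys the recurrence of the cofactor `X² +
(μ - 2)X + μ(μ - 2)`. Its lower coefficients sum to less than 1, so the bound reproduces itself. -/
theorem abs_le_of_recurrence {μ : ℝ} (hμ : μ ^ 3 - 2 * μ ^ 2 - 1 = 0) (h1 : 2.2055 < μ)
    (h2 : μ < 2.2056) (n : ℕ) :
    let d : ℕ → ℝ := fun n => (μ ^ 2 + μ - 3) / 2 * (wt n 0 : ℝ) - wt n 1 - wt n 2
    |d n| ≤ 1.6 ∧ |d (n + 1)| ≤ 1.6 := by
  intro d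
  induction n with
  | zero =>
    have e0 : d 0 = (μ ^ 2 + μ - 3) / 2 * 19 - 24 - 16 := by simp [d, wt]
    have e1 : d 1 = (μ ^ 2 + μ - 3) / 2 * 43 - 51 - 35 := by simp [d, wt]
    rw [zero_add, e0, e1, abs_le, abs_le]
    refine ⟨⟨?_, ?_⟩, ?_, ?_⟩ <;> nlinarith
  | succ n ih =>
    refine ⟨ih.2, ?_⟩
    have hrec : d (n + 1 + 1) = -((μ - 2) * d (n + 1)) - μ * (μ - 2) * d n := by
      simp only [d, wt, Matrix.cons_val_zero, Matrix.cons_val_one, Matrix.cons_val]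
      push_cast
      linear_combination ((μ + 2) / 2 * (wt n 0 : ℝ) + 1 / 2 * (wt n 1 : ℝ)) * hμ
    rw [hrec]
    have a1 : |(μ - 2) * d (n + 1)| ≤ 0.2056 * 1.6 := by
      rw [abs_mul, abs_of_pos (by linarith)]
      exact mul_le_mul (by linarith) ih.2 (abs_nonneg _) (by norm_num)
    have a2 : |μ * (μ - 2) * d n| ≤ 0.46 * 1.6 := by
      rw [abs_mul, abs_of_pos (mul_pos (by linarith) (by linarith))]
      exact mul_le_mul (by nlinarith) ih.1 (abs_nonneg _) (by norm_num)
    rw [abs_le] at *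
    constructor <;> linarith

/-- The image of a run of `x` under `τ ∘ g ∘ fⁿ`. -/
theorem exists_match_z (n : ℕ) {s t q : ℕ} {bl br : Bool} (h : Run x s t q)
    (hl : LType s q bl) (hr : RType t q br) (hs : 1 ≤ s) (hpar : par (s + q) = par s) :
    ∃ S N p, Match z S N p ∧ p + pos x (wt n) s = pos x (wt n) (s + q) ∧
      N + pos x (wt n) s = S + pos x (wt n) t + extL n bl + extR n br := by
  induction n generalizing s t q bl br with
  | zero =>
    obtain ⟨p, hp⟩ : ∃ p, Z (s + q) = Z s + p := Nat.exists_eq_add_of_le (Z_mono (by omega))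
    obtain ⟨S, hS, -, -, h2⟩ := h.lift_z hp hpar hl hr
    refine ⟨S, _, p, hS.isMatch, ?_, ?_⟩
    · rw [← Z, ← Z]; omega
    · have := h2 hs
      rw [← Z, ← Z]; omega
  | succ n ih =>
    obtain ⟨p, hp⟩ : ∃ p, F (s + q) = F s + p :=
      Nat.exists_eq_add_of_le (pos_mono _ _ (by omega))
    obtain ⟨s', t', bl', hrun, hl', hr', hs', ht', hroot, hright, -, hleft⟩ := h.lift_wt hp hl hr
    obtain ⟨hs1, rfl, hleft⟩ := hleft hs
    have hFst : F s ≤ F t := pos_mono _ _ h.le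
    have hpar' : par (s' + p) = par s' := by
      rw [← hrun.isMatch.par_add hs' (by omega), ← hp, par_F, par_F, hpar]
    obtain ⟨S, N, P, hm, e1, e2⟩ := ih hrun hl' hr' hs1 hpar'
    have := hroot n
    have := hright n
    have := hleft n
    exact ⟨S, N, P, hm, by omega, by omega⟩

/-- The seed is the empty run of period 1 at position 2 of `x = 0102⋯`, with mismatches `1,0` and
`0,2`, lifted `n` times and then to `z`. -/
theorem exists_match_z_wt (n : ℕ) :
    ∃ S, Match z S (S + (extL n false + extR n false)) (wt n 0) := by
  have h1 : x 1 = 1 := occursAt_zero 1 (by decide)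
  have h2 : x 2 = 0 := occursAt_zero 2 (by decide)
  have h3 : x 3 = 2 := occursAt_zero 3 (by decide)
  have hrun : Run x 2 2 1 := by
    refine ⟨le_rfl, fun j h1 h2 => absurd h2 (by omega), ?_, ?_⟩
    · intro j hj
      obtain rfl : j = 1 := by omega
      rw [h1, h2]; decide
    · rw [h2, h3]; decide
  obtain ⟨S, N, p, hm, e1, e2⟩ := exists_match_z n (bl := false) (br := false) hrun
    (.inr ⟨1, rfl, by rw [h2]; simp⟩) (by rw [RType, h2]; simp) (by omega)
    (by rw [par, h2]; cases par 2 <;> rfl)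
  rw [pos_succ _ _ 2, h2] at e1
  obtain rfl : p = wt n 0 := by omega
  obtain rfl : N = S + (extL n false + extR n false) := by omega
  exact ⟨S, hm⟩

/-! ### The critical exponent -/

section CriticalExponent

variable {A : Type*}

theorem criticalExponent_le {w : ℕ → A} {C : ℝ}
    (h : ∀ S e p, 1 ≤ p → Match w S (S + e) p → (e : ℝ) ≤ C * p) :
    criticalExponent w ≤ ((1 + C : ℝ) : EReal) := by
  refine sSup_le ?_
  rintro a ⟨r, ⟨u, ⟨i, hi⟩, p, ⟨hp1, hp2, hp3⟩, rfl⟩, rfl⟩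
  obtain ⟨e, he⟩ := Nat.exists_eq_add_of_le hp2
  have hm : Match w i (i + e) p := by
    intro j h1 h2
    obtain ⟨k, rfl⟩ := Nat.exists_eq_add_of_le h1
    rw [add_assoc, ← hi (k + p) (by omega), ← hi k (by omega), hp3 k (by omega)]
  have := h i e p hp1 hm
  have hp : (0 : ℝ) < p := by exact_mod_cast hp1
  rw [EReal.coe_le_coe_iff, he]
  push_cast
  rw [div_le_iff₀ hp]
  linarith

theorem Match.le_criticalExponent {w : ℕ → A} {S e p : ℕ} (hp : 1 ≤ p)
    (h : Match w S (S + e) p) : ((1 + e / p : ℝ) : EReal) ≤ criticalExponent w := by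
  refine le_sSup ⟨((p + e : ℕ) : ℚ) / p, ⟨(List.range (p + e)).map fun j => w (S + j),
    ⟨S, fun j hj => by simp⟩, p, ⟨hp, by simp, fun i hi => ?_⟩, by simp⟩, ?_⟩
  · simp only [List.length_map, List.length_range] at hi
    simp only [List.getElem_map, List.getElem_range]
    rw [← add_assoc]
    exact (h _ (by omega) (by omega)).symm
  · have hp : (p : ℝ) ≠ 0 := by positivity
    refine congrArg Real.toEReal ?_
    push_cast
    rw [add_div, div_self hp]

end CriticalExponent

theorem criticalExponent_z {μ : ℝ} (hμ : μ ^ 3 - 2 * μ ^ 2 - 1 = 0) (h1 : 2.2055 < μ)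
    (h2 : μ < 2.2056) (hC1 : 1.2587 < 1 / (3 - μ)) :
    criticalExponent z = ((1 + 1 / (3 - μ) : ℝ) : EReal) := by
  have hCμ : 1 / (3 - μ) = (μ ^ 2 + μ + 3) / 8 := by
    have : 3 - μ ≠ 0 := by linarith
    field_simp
    linear_combination hμ
  have hd := fun n => (abs_le_of_recurrence hμ h1 h2 n).1
  simp only [abs_le] at hd
  have hext := ext_eq
  generalize hC : 1 / (3 - μ) = C at *
  have hK : (μ ^ 2 + μ - 3) / 2 = 4 * C - 3 := by rw [hCμ]; ring
  rw [hK] at hd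
  have lower : ∀ n, ((extL n false + extR n false : ℕ) : ℝ) ≤ C * (wt n 0 : ℕ) := by
    intro n
    have := (hext n).1
    have hd := (hd n).1
    -- The additive constant is at least 3, more than the error 1.6, so the bound holds for every
    -- `n`.
    have h4 : 4 * (extL n false + extR n false) + 3 ≤ 3 * wt n 0 + wt n 1 + wt n 2 := by
      split_ifs at this <;> omega
    rify at h4
    push_cast
    linarith
  have upper : ∀ n, C * (wt n 0 : ℕ) ≤ ((extL n false + extR n false : ℕ) : ℝ) + 3 := by
    intro n
    have := (hext n).1
    have hd := (hd n).2
    have h4 : 3 * wt n 0 + wt n 1 + wt n 2 ≤ 4 * (extL n false + extR n false) + 9 := by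
      split_ifs at this <;> omega
    rify at h4
    push_cast
    linarith
  have hbound : ∀ {s t p : ℕ} {bl br : Bool}, Run x s t p → LType s p bl → RType t p br → 1 ≤ p →
      par (s + p) = par s → (Z t : ℝ) - Z s + extL 0 bl + extR 0 br ≤ C * (Z (s + p) - Z s) := by
    intro s t p bl br h hl hr hp hpar
    -- The two remaining kinds of runs have ratio at most `5/4`, which is below `C`.
    refine h.bound lower ?_ ?_ (by linarith) hl hr hp hpar 0
    · intro n
      have hb := wt_bounds n
      have h4 : 4 * (extL n true + extR n true) ≤ 10 * wt n 2 := by have := (hext n).2; omega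
      rify at h4
      have : 0 ≤ (C - 5 / 4) * (wt n 2 : ℝ) := mul_nonneg (by linarith) (by positivity)
      push_cast
      linarith
    · intro n
      have hb := wt_bounds n
      have h4 : 4 * (wt n 2 + extL n true + extR n true) ≤ 5 * wt n 0 + 10 * wt n 2 := by
        have := (hext n).2; omega
      rify at h4
      have : 0 ≤ (C - 5 / 4) * (wt n 0 + 2 * wt n 2 : ℝ) :=
        mul_nonneg (by linarith) (by positivity)
      push_cast
      linarith
  apply le_antisymm
  · refine criticalExponent_le fun S e p hp hm => ?_
    by_contra! hlt
    by_cases he : 35 ≤ e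
    · obtain ⟨s, t, q, bl, br, hrun, hl, hr, hq, hpar, hZ, hle⟩ := hm.exists_run_z hp (by omega)
      have := hbound hrun hl hr hq hpar
      rw [hZ] at this
      rify at hle
      push_cast at this
      linarith
    · have hp0 : (0 : ℝ) < p := by exact_mod_cast hp
      have h3 : 1.2587 * (p : ℝ) < e := (mul_lt_mul_of_pos_right hC1 hp0).trans hlt
      have h4 : 12587 * p < 10000 * e := by
        have : (12587 * p : ℝ) < 10000 * e := by linarith
        exact_mod_cast this
      have hs : shortLen p ≤ e := by unfold shortLen; omega
      have hp27 : p ≤ 27 := by omega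
      exact not_match_short hp hp27 S fun j hj1 hj2 => hm j hj1 (by omega)
  · refine le_of_forall_lt fun c hc => ?_
    obtain ⟨r, hcr, hr⟩ := EReal.lt_iff_exists_real_btwn.1 hc
    refine hcr.trans ?_
    have hr' : r < 1 + C := EReal.coe_lt_coe_iff.1 hr
    -- The critical family misses `1 + C` by at most `3 / wt n 0`.
    obtain ⟨n, hn⟩ := exists_nat_gt (3 / (1 + C - r))
    obtain ⟨S, hS⟩ := exists_match_z_wt n
    have hb := wt_bounds n
    have hn' : (n : ℝ) ≤ wt n 0 := by exact_mod_cast (by omega : n ≤ wt n 0)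
    have hpos : (0 : ℝ) < wt n 0 := by exact_mod_cast (by omega : 0 < wt n 0)
    refine lt_of_lt_of_le (EReal.coe_lt_coe_iff.2 ?_) (hS.le_criticalExponent (by omega))
    have h5 := hn.trans_le hn'
    rw [div_lt_iff₀ (by linarith)] at h5
    have h6 := upper n
    rw [← sub_lt_iff_lt_add', lt_div_iff₀ hpos]
    linarith

end RichWord

theorem mainTheorem3 :
    ∃ μ : ℝ,
      (∀ t : ℝ, t ^ 3 - 2 * t ^ 2 - 1 = 0 ↔ t = μ) ∧
      |μ - 2.20557| < 0.000005 ∧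
      |(1 + 1 / (3 - μ)) - 2.25876324| < 0.000000005 ∧
      RichWord.criticalExponent RichWord.z = ((1 + 1 / (3 - μ) : ℝ) : EReal) := by
  obtain ⟨μ, ⟨h1, h2⟩, hμ⟩ : ∃ μ ∈ Set.Icc (2.20556943 : ℝ) 2.205569431,
      μ ^ 3 - 2 * μ ^ 2 - 1 = 0 := by
    have hc : ContinuousOn (fun t : ℝ => t ^ 3 - 2 * t ^ 2 - 1)
        (Set.Icc 2.20556943 2.205569431) := by fun_prop
    have := intermediate_value_Icc (by norm_num) hc
    exact this ⟨by norm_num, by norm_num⟩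
  have h3 : 0 < 3 - μ := by linarith
  have hC1 : 2.25876324 - 0.000000005 < 1 + 1 / (3 - μ) := by
    rw [← sub_lt_iff_lt_add', lt_div_iff₀ h3]
    linarith
  have hC2 : 1 + 1 / (3 - μ) < 2.25876324 + 0.000000005 := by
    rw [← lt_sub_iff_add_lt', div_lt_iff₀ h3]
    linarith
  refine ⟨μ, fun t => ⟨fun ht => ?_, fun ht => ht ▸ hμ⟩, ?_, ?_,
    RichWord.criticalExponent_z hμ (by linarith) (by linarith) (by linarith)⟩
  -- A root satisfies `t²(t - 2) = 1`, so `t > 2`; then the quadratic cofactor `t(t - 2) + μ(μ - 2)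
  -- + tμ` is positive.
  · have ht2 : 2 < t := by
      by_contra! hle
      nlinarith [mul_nonneg (sq_nonneg t) (sub_nonneg.2 hle)]
    have hfac : (t - μ) * (t ^ 2 + t * μ + μ ^ 2 - 2 * (t + μ)) = 0 := by
      linear_combination ht - hμ
    rcases mul_eq_zero.1 hfac with h | h
    · linarith
    · nlinarith
  · rw [abs_lt]
    constructor <;> linarith
  · rw [abs_lt]
    constructor <;> linarith
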